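/- Let $p$ be a prime number. For a prime power $q$ let $\mathbf F_q$ be the field with $q$ elements, and for $n\ge 1$ let $\mathrm L_n^*(\mathbf F_q)$ be the poset of subspaces of $\mathbf F_q^n$ other than $0$ and $\mathbf F_q^n$, with its action of $\mathrm{GL}_n(\mathbf F_q)$. For $r\ge 1$ put $$\widetilde\chi^p_r(n,q)=\frac{1}{|\mathrm{GL}_n(\mathbf F_q)|}\sum_{X\in\mathrm{Hom}(\mathbf Z\times\mathbf Z_p^{r-1},\,\mathrm{GL}_n(\mathbf F_q))}\widetilde\chi\bigl(C_{\mathrm L_n^*(\mathbf F_q)}(X)\bigr),\qquad F^p_r(x)(q)=1+\sum_{n\ge1}\widetilde\chi^p_r(n,q)\,x^n\in\mathbf Q[[x]].$$ Here $\mathbf Z_p$ is the ring of $p$-adic integers, $C_{\mathrm L_n^*(\mathbf F_q)}(X)$ is the subposet of those subspaces in $\mathrm L_n^*(\mathbf F_q)$ that are invariant under the image of $X$, and $\widetilde\chi(P)=\sum_{c}(-1)^{|c|-1}$, summed over all chains $c$ of the finite poset $P$ including the empty chain, is the reduced Euler characteristic. Let $A^p(d)(q)$ be the number of monic irreducible polynomials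 $f\in\mathbf F_q[t]$ of degree $d$ with $f(0)\neq0$ whose order (the least $e\ge1$ with $f\mid t^e-1$) is a power of $p$ (including $p^0=1$). For a sequence $A=(A(d))_{d\ge1}$ of integer-valued functions of $q$ and a series $F(x)(q)=1+\sum_{n\ge1}a(n)(q)x^n$ whose coefficients are functions of $q$, the $A$-transform of $F$ is $T_A(F)(x)(q)=1+\sum_{n\ge1}T_A(a)(n)(q)\,x^n$, where $$T_A(a)(n)(q)=\sum_{\lambda\in M_n}\ \prod_{d}\binom{A(d)(q)}{[\,e(m,d)\mid (m,d)\in\lambda\,]}\ \prod_{(m,d)\in\lambda}a(m)(q^d)^{e(m,d)}.$$ Here $M_n$ is the set of finite multisets $\lambda$ of pairs $(m,d)$ of positive integers, $(m,d)$ having multiplicity $e(m,d)$ in $\lambda$, with $\sum_{(m,d)\in\lambda} e(m,d)\,md=n$ (this sum and the last product being over the distinct pairs in $\lambda$); the first product is over the distinct $d$ that occur as second coordinates in $\lambda$, and $\binom{N}{k_1,\dots,k_s}=\frac{N(N-1)\cdots(N+1-\sum k_i)}{k_1!\cdots k_s!}$. **Theorem 5.4.** For every prime $p$, every prime power $q$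 and every $r\ge1$, the generating function $F^p_{r+1}(x)(q)$ is the $(A^p(d)(q))_{d\ge1}$-transform of $F^p_r(x)(q)$: $$F^p_{r+1}(x)(q)=T_{A^p}(F^p_r)(x)(q).$$ Equivalently, $$F^p_{r+1}(x)(q)=\prod_{d\ge1}\bigl(F^p_r(x^d)(q^d)\bigr)^{A^p(d)(q)},$$ the infinite product converging coefficientwise as a formal power series. -/

import Mathlib

open scoped Polynomial PowerSeries

namespace PPrimary

noncomputable section

/-! ### The finite field with `q` elements -/

/-- The finite field with `q` elements, for a prime power `q`. -/
def FF (q : ℕ) (hq : IsPrimePow q) : Type :=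
  haveI : Fact q.minFac.Prime := ⟨Nat.minFac_prime hq.ne_one⟩
  GaloisField q.minFac (q.factorization q.minFac)

instance instFieldFF (q : ℕ) (hq : IsPrimePow q) : Field (FF q hq) :=
  haveI : Fact q.minFac.Prime := ⟨Nat.minFac_prime hq.ne_one⟩
  inferInstanceAs (Field (GaloisField q.minFac (q.factorization q.minFac)))

instance instFiniteFF (q : ℕ) (hq : IsPrimePow q) : Finite (FF q hq) :=
  haveI : Fact q.minFac.Prime := ⟨Nat.minFac_prime hq.ne_one⟩
  inferInstanceAs (Finite (GaloisField q.minFac (q.factorization q.minFac)))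

theorem card_FF (q : ℕ) (hq : IsPrimePow q) : Nat.card (FF q hq) = q := by
  have : Fact q.minFac.Prime := ⟨Nat.minFac_prime hq.ne_one⟩
  have h0 : q.factorization q.minFac ≠ 0 := by
    intro h
    have := hq.minFac_pow_factorization_eq
    rw [h, pow_zero] at this
    exact hq.ne_one this.symm
  exact (GaloisField.card q.minFac _ h0).trans hq.minFac_pow_factorization_eq

/-! ### Reduced Euler characteristics of finite posets -/

/-- The reduced Euler characteristic of (the order complex of) a finite poset: every chain with
`k` elements, the empty one included, is a simplex of dimension `k - 1` and contributes
`(-1) ^ (k - 1) = (-1) ^ (k + 1)`. -/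
def reducedEuler (P : Type*) [PartialOrder P] : ℤ :=
  ∑ᶠ c : {c : Finset P // IsChain (· ≤ ·) (c : Set P)}, (-1 : ℤ) ^ (c.1.card + 1)

/-! ### The `p`-primary equivariant reduced Euler characteristic -/

/-- The abelian group `ℤ × ℤ_p ^ (r - 1)`, written multiplicatively. -/
abbrev Source (p : ℕ) [Fact p.Prime] (r : ℕ) : Type :=
  Multiplicative (ℤ × (Fin (r - 1) → ℤ_[p]))

/-- For a homomorphism `X : A → GL(V)`, the poset (under inclusion) of the subspaces of `V` that
are different from `0` and `V` and invariant under `X(A)`. -/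
def invariantProper {A : Type*} [Group A] {K V : Type*} [Field K] [AddCommGroup V] [Module K V]
    (X : A →* LinearMap.GeneralLinearGroup K V) : Set (Submodule K V) :=
  {U | U ≠ ⊥ ∧ U ≠ ⊤ ∧ ∀ a, ∀ v ∈ U, (X a : V →ₗ[K] V) v ∈ U}

/-- The normalized sum
`|GL(V)|⁻¹ ∑_{X : ℤ × ℤ_p ^ (r - 1) → GL(V)} χ̃(X-invariant proper nonzero subspaces of V)`.
The sum is over a finite set, see `finite_hom`. -/
def equivariantEuler (p : ℕ) [Fact p.Prime] (r : ℕ) (K V : Type*) [Field K] [AddCommGroup V]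
    [Module K V] : ℚ :=
  (∑ᶠ X : Source p r →* LinearMap.GeneralLinearGroup K V,
      (reducedEuler (invariantProper X) : ℚ)) /
    (Nat.card (LinearMap.GeneralLinearGroup K V) : ℚ)

/-- The sum in `equivariantEuler` is finite: there are only finitely many homomorphisms from
`ℤ × ℤ_p ^ (r - 1)` to a finite group. -/
theorem finite_hom (p : ℕ) [hp : Fact p.Prime] (r : ℕ) (G : Type*) [Group G] [Finite G] :
    Finite (Source p r →* G) := by
  classical
  set N := Nat.card G with hN
  have hN0 : N ≠ 0 := Nat.card_pos.ne'
  have key : ∀ z : ℤ_[p], ∃ (m : ℕ) (y : ℤ_[p]), z = m + N * y := by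
    intro z
    obtain ⟨k, u, hu, hk⟩ := Nat.exists_eq_pow_mul_and_not_dvd hN0 p hp.out.ne_one
    have hu' : IsUnit ((u : ℕ) : ℤ_[p]) := by
      rw [PadicInt.isUnit_iff]
      refine le_antisymm (PadicInt.norm_le_one _) (not_lt.mp fun h => ?_)
      have h' : ‖((u : ℤ) : ℤ_[p])‖ < 1 := by exact_mod_cast h
      rw [PadicInt.norm_int_lt_one_iff_dvd] at h'
      exact hu (by exact_mod_cast h')
    obtain ⟨w, hw⟩ := Ideal.mem_span_singleton.mp (PadicInt.appr_spec k z)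
    obtain ⟨v, hv⟩ := hu'.exists_right_inv
    refine ⟨z.appr k, v * w, ?_⟩
    have : z = z.appr k + p ^ k * w := by rw [← hw]; ring
    rw [hk]; push_cast
    calc z = z.appr k + p ^ k * w := this
      _ = z.appr k + p ^ k * ((u : ℤ_[p]) * v) * w := by rw [hv, mul_one]
      _ = _ := by ring
  let f : (Source p r →* G) → G × (Fin (r - 1) → G) := fun X =>
    (X (Multiplicative.ofAdd (1, 0)), fun i => X (Multiplicative.ofAdd (0, Pi.single i 1)))
  refine Finite.of_injective f ?_
  intro X Y h
  have h1 := congrArg Prod.fst h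
  have h2 := fun i => congrFun (congrArg Prod.snd h) i
  simp only [f] at h1 h2
  suffices hS : ∀ a, a ∈ MonoidHom.eqLocus X Y from MonoidHom.ext hS
  intro a
  obtain ⟨⟨c, z⟩, rfl⟩ := Multiplicative.ofAdd.surjective a
  choose m y hmy using fun i => key (z i)
  have e : Multiplicative.ofAdd ((c, z) : ℤ × (Fin (r - 1) → ℤ_[p])) =
      (Multiplicative.ofAdd ((1, 0) : ℤ × (Fin (r - 1) → ℤ_[p]))) ^ c *
      (∏ i, (Multiplicative.ofAdd ((0, Pi.single i 1) : ℤ × (Fin (r - 1) → ℤ_[p]))) ^ m i) *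
      (Multiplicative.ofAdd ((0, y) : ℤ × (Fin (r - 1) → ℤ_[p]))) ^ N := by
    apply Multiplicative.toAdd.injective
    simp only [toAdd_mul, toAdd_prod, toAdd_pow, toAdd_zpow, toAdd_ofAdd]
    ext i
    · simp [Prod.fst_sum]
    · simp [Prod.snd_sum, Finset.sum_apply, Pi.single_apply, hmy i]
  rw [e]
  refine mul_mem (mul_mem (zpow_mem h1 c) (prod_mem fun i _ => pow_mem (h2 i) _)) ?_
  change X _ = Y _
  rw [map_pow, map_pow, pow_card_eq_one', pow_card_eq_one']

/-- `χ̃_r^p(n, q)`, the `r`-th `p`-primary equivariant reduced Euler characteristic of the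
`GL_n(𝔽_q)`-poset of nonzero proper subspaces of `𝔽_q ^ n` (`0` if `q` is not a prime power). -/
def chi (p : ℕ) [Fact p.Prime] (r n q : ℕ) : ℚ :=
  open Classical in
  if hq : IsPrimePow q then equivariantEuler p r (FF q hq) (Fin n → FF q hq) else 0

/-- The `r`-th `p`-primary generating function `F_r^p(x)(q) = 1 + ∑_{n ≥ 1} χ̃_r^p(n, q) x ^ n`
at `q`. -/
def genFun (p : ℕ) [Fact p.Prime] (r q : ℕ) : ℚ⟦X⟧ :=
  PowerSeries.mk fun n => if n = 0 then 1 else chi p r n q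

/-! ### Irreducible polynomials of `p`-power order -/

/-- The order of a polynomial `f` with `f(0) ≠ 0` over a finite field: the least positive integer
`e` such that `f` divides `t ^ e - 1`. -/
def polyOrder {K : Type*} [Field K] (f : K[X]) : ℕ :=
  sInf {e : ℕ | 0 < e ∧ f ∣ Polynomial.X ^ e - 1}

/-- `A^p(d)(q)`, the number of monic irreducible polynomials over `𝔽_q`, of degree `d`, with
nonzero constant term, whose order is a power of `p` (`0` if `q` is not a prime power). -/
def irrCount (p d q : ℕ) : ℕ :=
  open Classical in
  if hq : IsPrimePow q then
    Set.ncard {f : (FF q hq)[X] | f.Monic ∧ Irreducible f ∧ f.natDegree = d ∧ f.coeff 0 ≠ 0 ∧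
      ∃ k : ℕ, polyOrder f = p ^ k}
  else 0

/-! ### The `A`-transform -/

/-- The set `M_n` of all multisets `λ` of pairs `(m, d)` of positive integers for which the
multiset of all products `m d` is a partition of `n`. A multiset is given by its multiplicities
`e(m, d)`. -/
def pairMultisets (n : ℕ) : Set (ℕ+ × ℕ+ →₀ ℕ) :=
  {e | (e.sum fun md k => k * (md.1 * md.2 : ℕ)) = n}

/-- The multinomial coefficient `a (a - 1) ⋯ (a + 1 - ∑ k_i) / ∏ k_i!`. -/
def multinom {ι : Type*} (a : ℤ) (s : Finset ι) (k : ι → ℕ) : ℚ :=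
  (∏ j ∈ Finset.range (∑ i ∈ s, k i), ((a : ℚ) - j)) / ∏ i ∈ s, ((k i).factorial : ℚ)

/-- The `n`-th element, at `q`, of the `A`-transform of a sequence `a`. Here `A d q` stands for
`A(d)(q)` and `a m q` for `a(m)(q)`. -/
def seqTransform (A : ℕ → ℕ → ℤ) (a : ℕ → ℕ → ℚ) (n q : ℕ) : ℚ :=
  ∑ᶠ e ∈ pairMultisets n,
    (∏ d ∈ e.support.image Prod.snd,
      multinom (A d q) (e.support.filter fun md => md.2 = d) e) *
    ∏ md ∈ e.support, a md.1 (q ^ (md.2 : ℕ)) ^ e md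

/-- The `A`-transform of a power series `F(x) = 1 + ∑_{n ≥ 1} a(n) x ^ n` whose coefficients are
functions of `q`: the generating function of the `A`-transform of its coefficient sequence. -/
def seriesTransform (A : ℕ → ℕ → ℤ) (F : ℕ → ℚ⟦X⟧) (q : ℕ) : ℚ⟦X⟧ :=
  PowerSeries.mk fun n =>
    if n = 0 then 1 else seqTransform A (fun m q' => PowerSeries.coeff m (F q')) n q

/-- The formal infinite product `∏_{d ≥ 1} f d` converges to `F`: for each `n`, all sufficiently
large finite partial products have the same coefficient of `x ^ n` as `F`. -/
def HasFormalProd (f : ℕ+ → ℚ⟦X⟧) (F : ℚ⟦X⟧) : Prop :=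
  ∀ n : ℕ, ∀ᶠ s : Finset ℕ+ in Filter.atTop,
    PowerSeries.coeff n (∏ d ∈ s, f d) = PowerSeries.coeff n F

end

end PPrimary

namespace PPrimary

noncomputable section

/-! ### Möbius numbers of finite bounded posets -/

section Poset

open Classical in
theorem reducedEuler_coe_set {L : Type*} [PartialOrder L] [Fintype L] (s : Set L) :
    reducedEuler s = ∑ c ∈ Finset.univ.filter fun c : Finset L =>
      IsChain (· ≤ ·) (c : Set L) ∧ (c : Set L) ⊆ s, (-1 : ℤ) ^ (c.card + 1) := by
  rw [reducedEuler, finsum_eq_sum_of_fintype]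
  refine Finset.sum_bij (fun c _ => c.1.map (Function.Embedding.subtype _)) ?_ ?_ ?_ ?_
  · rintro ⟨c, hc⟩ -
    simp only [Finset.mem_filter, Finset.mem_univ, true_and, Finset.coe_map,
      Function.Embedding.subtype_apply]
    refine ⟨?_, by rintro _ ⟨x, -, rfl⟩; exact x.2⟩
    rintro _ ⟨x, hx, rfl⟩ _ ⟨y, hy, rfl⟩ hxy
    exact hc hx hy (fun h => hxy (by rw [h]))
  · rintro ⟨c, hc⟩ - ⟨d, hd⟩ - h
    exact Subtype.ext (Finset.map_injective (Function.Embedding.subtype _) h)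
  · intro c hc
    simp only [Finset.mem_filter, Finset.mem_univ, true_and] at hc
    refine ⟨⟨c.subtype (· ∈ s), ?_⟩, Finset.mem_univ _, ?_⟩
    · intro x hx y hy hxy
      exact hc.1 (by simpa using hx) (by simpa using hy) (fun h => hxy (Subtype.ext h))
    · exact Finset.subtype_map_of_mem fun x hx => hc.2 hx
  · rintro ⟨c, hc⟩ -
    simp

theorem reducedEuler_congr {P Q : Type*} [PartialOrder P] [PartialOrder Q] (e : P ≃o Q) :
    reducedEuler P = reducedEuler Q := by
  unfold reducedEuler
  refine finsum_eq_of_bijective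
    (fun c => ⟨c.1.map e.toEmbedding, ?_⟩) ⟨?_, ?_⟩ ?_
  · rintro _ hx _ hy hxy
    simp only [Finset.coe_map, Set.mem_image] at hx hy
    obtain ⟨x, hx, rfl⟩ := hx
    obtain ⟨y, hy, rfl⟩ := hy
    have := c.2 hx hy (fun h => hxy (by rw [h]))
    simpa using this
  · rintro ⟨c, hc⟩ ⟨d, hd⟩ h
    exact Subtype.ext (Finset.map_injective _ (congrArg Subtype.val h))
  · rintro ⟨c, hc⟩
    refine ⟨⟨c.map e.symm.toEmbedding, ?_⟩, ?_⟩
    · rintro _ hx _ hy hxy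
      simp only [Finset.coe_map, Set.mem_image] at hx hy
      obtain ⟨x, hx, rfl⟩ := hx
      obtain ⟨y, hy, rfl⟩ := hy
      have := hc hx hy (fun h => hxy (by rw [h]))
      simpa using this
    · apply Subtype.ext
      ext x
      simp
  · intro c
    simp

open Classical in
/-- The value `μ(⊥, z)` of the Möbius function, given by Philip Hall's formula. -/
def moebiusBot {L : Type*} [PartialOrder L] [OrderBot L] (z : L) : ℤ :=
  if z = ⊥ then 1 else reducedEuler (Set.Ioo ⊥ z)

theorem moebiusBot_bot {L : Type*} [PartialOrder L] [OrderBot L] :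
    moebiusBot (⊥ : L) = 1 := if_pos rfl

open Classical in
theorem reducedEuler_Ioo_bot {L : Type*} [PartialOrder L] [OrderBot L] [Fintype L] (z : L) :
    reducedEuler (Set.Ioo ⊥ z) =
      -1 - ∑ y : L with y ∈ Set.Ioo ⊥ z, reducedEuler (Set.Ioo ⊥ y) := by
  set T : L → Finset (Finset L) := fun z =>
    Finset.univ.filter fun c : Finset L =>
      IsChain (· ≤ ·) (c : Set L) ∧ (c : Set L) ⊆ Set.Ioo ⊥ z with hT
  have hTz : ∀ z, reducedEuler (Set.Ioo ⊥ z) = ∑ c ∈ T z, (-1 : ℤ) ^ (c.card + 1) := fun z =>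
    reducedEuler_coe_set _
  have he : ∅ ∈ T z := by simp [hT]
  rw [hTz, ← Finset.add_sum_erase _ _ he]
  simp only [hTz]
  rw [Finset.sum_sigma', sub_eq_add_neg, ← Finset.sum_neg_distrib]
  congr 1
  symm
  refine Finset.sum_bij (fun yc _ => insert yc.1 yc.2) ?_ ?_ ?_ ?_
  · rintro ⟨y, c⟩ h
    simp only [hT, Finset.mem_sigma, Finset.mem_filter, Finset.mem_univ, true_and,
      Finset.mem_erase, Finset.coe_insert] at h ⊢
    obtain ⟨hy, hc, hcs⟩ := h
    refine ⟨Finset.insert_ne_empty _ _, hc.insert fun b hb _ => Or.inr (hcs hb).2.le, ?_⟩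
    rintro x (rfl | hx)
    · exact hy
    · exact ⟨(hcs hx).1, (hcs hx).2.trans hy.2⟩
  · rintro ⟨y, c⟩ h ⟨y', c'⟩ h' heq
    simp only [hT, Finset.mem_sigma, Finset.mem_filter, Finset.mem_univ, true_and] at h h' heq
    have hyc : y ∉ c := fun hh => (h.2.2 hh).2.ne rfl
    have hyc' : y' ∉ c' := fun hh => (h'.2.2 hh).2.ne rfl
    have hyy : y = y' := by
      have h1 : y ∈ insert y' c' := heq ▸ Finset.mem_insert_self _ _
      have h2 : y' ∈ insert y c := heq ▸ Finset.mem_insert_self _ _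
      rcases Finset.mem_insert.1 h1 with h1 | h1
      · exact h1
      rcases Finset.mem_insert.1 h2 with h2 | h2
      · exact h2.symm
      exact absurd ((h'.2.2 h1).2.trans (h.2.2 h2).2) (lt_irrefl _)
    subst hyy
    have : c = c' := by
      rw [← Finset.erase_insert hyc, heq, Finset.erase_insert hyc']
    rw [this]
  · intro c hc
    simp only [hT, Finset.mem_erase, Finset.mem_filter, Finset.mem_univ, true_and] at hc
    obtain ⟨hne, hc, hcs⟩ := hc
    obtain ⟨y, hy⟩ := c.exists_maximal (Finset.nonempty_iff_ne_empty.2 hne)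
    have hgr : ∀ x ∈ c, x ≤ y := fun x hx => by
      rcases hc.total hx hy.1 with h | h
      · exact h
      · exact hy.2 hx h
    refine ⟨⟨y, c.erase y⟩, ?_, Finset.insert_erase hy.1⟩
    simp only [hT, Finset.mem_sigma, Finset.mem_filter, Finset.mem_univ, true_and]
    refine ⟨hcs hy.1, hc.mono (by simp), fun x hx => ?_⟩
    have hx' : x ≠ y ∧ x ∈ c := by simpa [and_comm] using hx
    exact ⟨(hcs hx'.2).1, lt_of_le_of_ne (hgr x hx'.2) hx'.1⟩
  · rintro ⟨y, c⟩ h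
    simp only [hT, Finset.mem_sigma, Finset.mem_filter, Finset.mem_univ, true_and] at h
    have hyc : y ∉ c := fun hh => (h.2.2 hh).2.ne rfl
    rw [Finset.card_insert_of_notMem hyc]
    ring

open Classical in
theorem sum_moebiusBot {L : Type*} [PartialOrder L] [OrderBot L] [Fintype L] {z : L}
    (hz : z ≠ ⊥) : ∑ y : L with y ≤ z, moebiusBot y = 0 := by
  have h1 : (Finset.univ.filter fun y : L => y ≤ z) =
      insert ⊥ (insert z (Finset.univ.filter fun y : L => y ∈ Set.Ioo ⊥ z)) := by
    ext y
    simp only [Finset.mem_filter, Finset.mem_univ, true_and, Finset.mem_insert, Set.mem_Ioo]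
    constructor
    · intro h
      rcases eq_or_ne y ⊥ with rfl | hy
      · exact Or.inl rfl
      rcases h.eq_or_lt with rfl | h
      · exact Or.inr (Or.inl rfl)
      · exact Or.inr (Or.inr ⟨bot_lt_iff_ne_bot.2 hy, h⟩)
    · rintro (rfl | rfl | h)
      · exact bot_le
      · exact le_rfl
      · exact h.2.le
  have h2 : ∑ y ∈ Finset.univ.filter (fun y : L => y ∈ Set.Ioo ⊥ z), moebiusBot y =
      ∑ y ∈ Finset.univ.filter (fun y : L => y ∈ Set.Ioo ⊥ z), reducedEuler (Set.Ioo ⊥ y) := by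
    refine Finset.sum_congr rfl fun y hy => if_neg ?_
    rintro rfl
    simp at hy
  rw [h1, Finset.sum_insert, Finset.sum_insert, moebiusBot_bot, h2, moebiusBot, if_neg hz,
    reducedEuler_Ioo_bot]
  · ring
  · simp
  · simp [hz.symm]

open Classical in
/-- The Möbius function is determined by its recursion. -/
theorem eq_moebiusBot {L : Type*} [PartialOrder L] [OrderBot L] [Fintype L] (N : L → ℤ)
    (h0 : N ⊥ = 1) (h : ∀ z ≠ ⊥, ∑ y : L with y ≤ z, N y = 0) (z : L) : N z = moebiusBot z := by
  induction z using WellFoundedLT.induction with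
  | ind z ih =>
    rcases eq_or_ne z ⊥ with rfl | hz
    · rw [h0, moebiusBot_bot]
    have h1 := h z hz
    have h2 := sum_moebiusBot hz
    have hm : z ∈ Finset.univ.filter fun y : L => y ≤ z := by simp
    rw [← Finset.add_sum_erase _ _ hm] at h1 h2
    have h3 : ∑ y ∈ (Finset.univ.filter fun y : L => y ≤ z).erase z, N y =
        ∑ y ∈ (Finset.univ.filter fun y : L => y ≤ z).erase z, moebiusBot y := by
      refine Finset.sum_congr rfl fun y hy => ih y ?_
      simp only [Finset.mem_erase, Finset.mem_filter, Finset.mem_univ, true_and] at hy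
      exact lt_of_le_of_ne hy.2 hy.1
    linarith

/-- The Möbius number `μ(⊥, ⊤)`. -/
def moebius (L : Type*) [PartialOrder L] [BoundedOrder L] : ℤ := moebiusBot (⊤ : L)

open Classical in
theorem moebius_congr {P Q : Type*} [PartialOrder P] [PartialOrder Q] [BoundedOrder P]
    [BoundedOrder Q] (e : P ≃o Q) : moebius P = moebius Q := by
  unfold moebius moebiusBot
  have h : (⊤ : P) = ⊥ ↔ (⊤ : Q) = ⊥ := by
    rw [← e.injective.eq_iff, map_top, map_bot]
  refine if_congr h rfl (reducedEuler_congr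
    { toEquiv := e.toEquiv.subtypeEquiv fun x => ?_, map_rel_iff' := ?_ })
  · have h1 : ⊥ < e x ↔ ⊥ < x := by rw [← map_bot e, e.lt_iff_lt]
    have h2 : e x < ⊤ ↔ x < ⊤ := by rw [← map_top e, e.lt_iff_lt]
    simp [Set.mem_Ioo, h1, h2]
  · intro a b
    exact e.le_iff_le

theorem moebius_of_subsingleton (L : Type*) [PartialOrder L] [BoundedOrder L] [Subsingleton L] :
    moebius L = 1 := if_pos (Subsingleton.elim _ _)

open Classical in
theorem moebius_prod (P Q : Type*) [PartialOrder P] [PartialOrder Q] [BoundedOrder P]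
    [BoundedOrder Q] [Finite P] [Finite Q] : moebius (P × Q) = moebius P * moebius Q := by
  have := Fintype.ofFinite P
  have := Fintype.ofFinite Q
  symm
  refine eq_moebiusBot (fun x : P × Q => moebiusBot x.1 * moebiusBot x.2) ?_ ?_ ⊤
  · simp [moebiusBot_bot]
  · rintro ⟨a, b⟩ hab
    refine (Finset.sum_congr (s₂ := (Finset.univ.filter fun y : P => y ≤ a) ×ˢ
      (Finset.univ.filter fun y : Q => y ≤ b)) (by ext ⟨x, y⟩; simp) fun _ _ => rfl).trans ?_
    rw [Finset.sum_product, ← Finset.sum_mul_sum]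
    by_cases ha : a = ⊥
    · have hb : b ≠ ⊥ := fun hb => hab (by rw [ha, hb]; rfl)
      rw [sum_moebiusBot hb, mul_zero]
    · rw [sum_moebiusBot ha, zero_mul]

open Classical in
/-- A case of Weisner's theorem. -/
theorem moebius_eq_zero {L : Type*} [Lattice L] [BoundedOrder L] [Finite L] (a : L)
    (ha : a ≠ ⊥) (h : ∀ x, x ⊔ a = ⊤ → x = ⊤) : moebius L = 0 := by
  have := Fintype.ofFinite L
  have key : ∀ z, a ≤ z → ∑ x : L with x ⊔ a = z, moebiusBot x = 0 := by
    intro z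
    induction z using WellFoundedLT.induction with
    | ind z ih =>
      intro haz
      have hz : z ≠ ⊥ := fun hz => ha (le_bot_iff.1 (hz ▸ haz))
      have h1 := sum_moebiusBot hz
      rw [← Finset.sum_fiberwise_of_maps_to (g := fun x => x ⊔ a)
        (t := Finset.univ.filter fun w => a ≤ w ∧ w ≤ z)] at h1
      · have hm : z ∈ Finset.univ.filter fun w => a ≤ w ∧ w ≤ z := by simp [haz]
        rw [← Finset.add_sum_erase _ _ hm, Finset.sum_eq_zero (s := Finset.erase _ _),
          add_zero] at h1
        · rw [← h1]
          refine Finset.sum_congr ?_ fun _ _ => rfl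
          ext x
          simp only [Finset.mem_filter, Finset.mem_univ, true_and]
          exact ⟨fun hx => ⟨hx ▸ le_sup_left, hx⟩, fun hx => hx.2⟩
        · intro w hw
          simp only [Finset.mem_erase, Finset.mem_filter, Finset.mem_univ, true_and] at hw
          rw [← ih w (lt_of_le_of_ne hw.2.2 hw.1) hw.2.1]
          refine Finset.sum_congr ?_ fun _ _ => rfl
          ext x
          simp only [Finset.mem_filter, Finset.mem_univ, true_and]
          exact ⟨fun hx => hx.2, fun hx => ⟨(hx ▸ le_sup_left : x ≤ w).trans hw.2.2, hx⟩⟩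
      · intro x hx
        simp only [Finset.mem_filter, Finset.mem_univ, true_and] at hx ⊢
        exact ⟨le_sup_right, sup_le hx haz⟩
  have := key ⊤ le_top
  rw [Finset.sum_eq_single (⊤ : L)] at this
  · exact this
  · intro x hx hne
    simp only [Finset.mem_filter, Finset.mem_univ, true_and] at hx
    exact absurd (h x hx) hne
  · simp

end Poset

/-! ### Lattices of invariant subspaces -/

section Invariant

variable {B K V : Type*} [Group B] [Field K] [AddCommGroup V] [Module K V]

/-- The lattice of all subspaces invariant under a representation. -/
def invSub (X : B →* LinearMap.GeneralLinearGroup K V) : Sublattice (Submodule K V) where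
  carrier := {U | ∀ b, ∀ v ∈ U, (X b : V →ₗ[K] V) v ∈ U}
  supClosed' := by
    intro U hU W hW b v hv
    obtain ⟨u, hu, w, hw, rfl⟩ := Submodule.mem_sup.1 hv
    rw [map_add]
    exact Submodule.add_mem_sup (hU b u hu) (hW b w hw)
  infClosed' := fun U hU W hW b v hv => ⟨hU b v hv.1, hW b v hv.2⟩

instance (X : B →* LinearMap.GeneralLinearGroup K V) : BoundedOrder (invSub X) where
  top := ⟨⊤, fun _ _ _ => trivial⟩
  le_top _ := show _ ≤ (⊤ : Submodule K V) from le_top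
  bot := ⟨⊥, fun b v hv => by
    rw [(Submodule.mem_bot K).1 hv, map_zero]; exact Submodule.zero_mem _⟩
  bot_le _ := show (⊥ : Submodule K V) ≤ _ from bot_le

instance [Finite V] (X : B →* LinearMap.GeneralLinearGroup K V) : Finite (invSub X) := by
  have : Finite (Submodule K V) := Finite.of_injective _ SetLike.coe_injective
  exact Subtype.finite

/-- The Möbius number of the lattice of invariant subspaces. -/
def weight (X : B →* LinearMap.GeneralLinearGroup K V) : ℤ := moebius (invSub X)

theorem weight_of_subsingleton [Subsingleton V] (X : B →* LinearMap.GeneralLinearGroup K V) :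
    weight X = 1 := by
  have : Subsingleton (invSub X) := ⟨fun U W => Subtype.ext (Subsingleton.elim _ _)⟩
  exact moebius_of_subsingleton _

theorem weight_of_nontrivial [Nontrivial V] (X : B →* LinearMap.GeneralLinearGroup K V) :
    weight X = reducedEuler (invariantProper X) := by
  have h : (⊤ : invSub X) ≠ ⊥ := fun h =>
    top_ne_bot (α := Submodule K V) (congrArg Subtype.val h)
  rw [weight, moebius, moebiusBot, if_neg h]
  refine reducedEuler_congr
    { toFun := fun U => ⟨U.1.1, ?_, ?_, U.1.2⟩
      invFun := fun U => ⟨⟨U.1, U.2.2.2⟩, ?_, ?_⟩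
      left_inv := fun _ => rfl
      right_inv := fun _ => rfl
      map_rel_iff' := Iff.rfl }
  · exact fun h => U.2.1.ne' (Subtype.ext h)
  · exact fun h => U.2.2.ne (Subtype.ext h)
  · exact bot_lt_iff_ne_bot.2 fun h => U.2.1 (congrArg Subtype.val h)
  · exact lt_top_iff_ne_top.2 fun h => U.2.2.1 (congrArg Subtype.val h)

theorem aeval_intertwine {V' : Type*} [AddCommGroup V'] [Module K V'] (φ : V →ₗ[K] V')
    {g : Module.End K V} {g' : Module.End K V'} (h : ∀ v, φ (g v) = g' (φ v)) (p : K[X]) (v : V) :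
    φ (Polynomial.aeval g p v) = Polynomial.aeval g' p (φ v) := by
  induction p using Polynomial.induction_on' with
  | add p q hp hq => simp [hp, hq]
  | monomial n a =>
    have : ∀ v, φ ((g ^ n) v) = (g' ^ n) (φ v) := by
      induction n with
      | zero => simp
      | succ n ih => intro v; rw [pow_succ, pow_succ, Module.End.mul_apply, ih, h]; rfl
    simp [Polynomial.aeval_monomial, this, Algebra.algebraMap_eq_smul_one]

theorem aeval_mem_of_mem_invSub {X : B →* LinearMap.GeneralLinearGroup K V} {U : Submodule K V}
    (hU : U ∈ invSub X) (t : B) (p : K[X]) {v : V} (hv : v ∈ U) :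
    Polynomial.aeval (X t : Module.End K V) p v ∈ U := by
  have := aeval_intertwine U.subtype (g := (X t : Module.End K V).restrict (hU t))
    (g' := (X t : Module.End K V)) (fun v => rfl) p ⟨v, hv⟩
  exact this ▸ Submodule.coe_mem _

theorem ker_aeval_mem_invSub (X : B →* LinearMap.GeneralLinearGroup K V) {t : B}
    (ht : ∀ b, Commute b t) (p : K[X]) :
    LinearMap.ker (Polynomial.aeval (X t : Module.End K V) p) ∈ invSub X := by
  intro b v hv
  rw [LinearMap.mem_ker] at hv ⊢
  rw [← aeval_intertwine (X b : V →ₗ[K] V) (g := (X t : Module.End K V)), hv, map_zero]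
  intro w
  have := congrArg (fun g : LinearMap.GeneralLinearGroup K V => (g : V →ₗ[K] V) w)
    ((ht b).map X).eq
  exact this

/-- The restriction of a representation to an invariant subspace. -/
def restrictHom (X : B →* LinearMap.GeneralLinearGroup K V) {U : Submodule K V}
    (hU : U ∈ invSub X) : B →* LinearMap.GeneralLinearGroup K U :=
  MonoidHom.toHomUnits
    { toFun := fun b => (X b : V →ₗ[K] V).restrict (hU b)
      map_one' := by ext; simp
      map_mul' := fun a b => by ext; simp }

@[simp] theorem coe_restrictHom_apply (X : B →* LinearMap.GeneralLinearGroup K V)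
    {U : Submodule K V} (hU : U ∈ invSub X) (b : B) (u : U) :
    (((restrictHom X hU b : U →ₗ[K] U) u : U) : V) = (X b : V →ₗ[K] V) u := rfl

/-- The conjugate of a representation under a linear isomorphism. -/
def conjHom {V' : Type*} [AddCommGroup V'] [Module K V'] (φ : V ≃ₗ[K] V')
    (X : B →* LinearMap.GeneralLinearGroup K V) : B →* LinearMap.GeneralLinearGroup K V' :=
  (LinearMap.GeneralLinearGroup.congrLinearEquiv φ).toMonoidHom.comp X

@[simp] theorem conjHom_apply {V' : Type*} [AddCommGroup V'] [Module K V'] (φ : V ≃ₗ[K] V')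
    (X : B →* LinearMap.GeneralLinearGroup K V) (b : B) (v : V') :
    (conjHom φ X b : V' →ₗ[K] V') v = φ ((X b : V →ₗ[K] V) (φ.symm v)) := rfl

/-- The direct sum of two representations. -/
def prodHom {V' : Type*} [AddCommGroup V'] [Module K V']
    (X : B →* LinearMap.GeneralLinearGroup K V) (Y : B →* LinearMap.GeneralLinearGroup K V') :
    B →* LinearMap.GeneralLinearGroup K (V × V') :=
  MonoidHom.toHomUnits
    { toFun := fun b => (X b : V →ₗ[K] V).prodMap (Y b : V' →ₗ[K] V')
      map_one' := by ext <;> simp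
      map_mul' := fun a b => by ext <;> simp }

@[simp] theorem prodHom_apply {V' : Type*} [AddCommGroup V'] [Module K V']
    (X : B →* LinearMap.GeneralLinearGroup K V) (Y : B →* LinearMap.GeneralLinearGroup K V')
    (b : B) (v : V × V') : (prodHom X Y b : V × V' →ₗ[K] V × V') v =
      ((X b : V →ₗ[K] V) v.1, (Y b : V' →ₗ[K] V') v.2) := rfl

end Invariant

/-! ### Counting -/

instance {K V : Type*} [Field K] [AddCommGroup V] [Module K V] [Finite V] :
    Finite (LinearMap.GeneralLinearGroup K V) := by
  have : Finite (V →ₗ[K] V) := DFunLike.finite _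
  exact Finite.of_injective (fun g => (g : V →ₗ[K] V)) fun g h e => Units.ext e

theorem card_fiber_mul_finsum {Ω Z : Type*} [Finite Ω] [Finite Z] (R : Z → Ω → Prop)
    (w : Ω → ℚ) (w' : Z → ℚ) (c : ℕ) (hR : ∀ z, ∃! x, R z x) (hw : ∀ z x, R z x → w x = w' z)
    (hc : ∀ x, Nat.card {z // R z x} = c) : (c : ℚ) * ∑ᶠ x, w x = ∑ᶠ z, w' z := by
  classical
  have := Fintype.ofFinite Ω
  have := Fintype.ofFinite Z
  rw [finsum_eq_sum_of_fintype, finsum_eq_sum_of_fintype, Finset.mul_sum]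
  have h1 : ∀ x, (c : ℚ) * w x = ∑ z : Z, if R z x then w x else 0 := fun x => by
    rw [← Finset.sum_filter, Finset.sum_const, nsmul_eq_mul, ← hc x, Nat.card_eq_fintype_card,
      Fintype.card_subtype]
  simp_rw [h1]
  rw [Finset.sum_comm]
  refine Finset.sum_congr rfl fun z _ => ?_
  obtain ⟨x, hx, hu⟩ := hR z
  rw [Finset.sum_eq_single x, if_pos hx, hw z x hx]
  · exact fun y _ hy => if_neg fun h => hy (hu y h)
  · simp

theorem card_linearEquiv {K V W : Type*} [Field K] [AddCommGroup V] [Module K V] [AddCommGroup W]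
    [Module K W] (e : V ≃ₗ[K] W) :
    Nat.card (V ≃ₗ[K] W) = Nat.card (LinearMap.GeneralLinearGroup K V) := by
  rw [Nat.card_congr (LinearMap.GeneralLinearGroup.generalLinearEquiv K V).toEquiv]
  exact Nat.card_congr
    { toFun := fun f => f.trans e.symm
      invFun := fun f => f.trans e
      left_inv := fun f => by ext; simp
      right_inv := fun f => by ext; simp }

theorem card_linearEquiv' {K V W : Type*} [Field K] [AddCommGroup V] [Module K V] [AddCommGroup W]
    [Module K W] (e : V ≃ₗ[K] W) :
    Nat.card (V ≃ₗ[K] W) = Nat.card (LinearMap.GeneralLinearGroup K W) := by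
  rw [← card_linearEquiv e.symm]
  exact Nat.card_congr
    { toFun := fun f => f.symm
      invFun := fun f => f.symm
      left_inv := fun f => rfl
      right_inv := fun f => rfl }

/-- The normalized sum of the weights of the representations `X` of `B` on `V` such that the
polynomial `h` annihilates `X t`. -/
def eulerMass {B K : Type*} (V : Type*) [Group B] [Field K] [AddCommGroup V] [Module K V] (t : B)
    (h : K[X]) : ℚ :=
  (∑ᶠ X : {X : B →* LinearMap.GeneralLinearGroup K V //
    Polynomial.aeval (X t : Module.End K V) h = 0}, (weight X.1 : ℚ)) /
    Nat.card (LinearMap.GeneralLinearGroup K V)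

/-! ### Multiplicativity of the Euler mass -/

section Split

variable {B K V V₁ V₂ : Type*} [Group B] [Field K] [AddCommGroup V] [Module K V]
  [AddCommGroup V₁] [Module K V₁] [AddCommGroup V₂] [Module K V₂]

/-- `φ` identifies `X` with the direct sum of `X₁` and `X₂`. -/
def IsSum (φ : (V₁ × V₂) ≃ₗ[K] V) (X₁ : B →* LinearMap.GeneralLinearGroup K V₁)
    (X₂ : B →* LinearMap.GeneralLinearGroup K V₂) (X : B →* LinearMap.GeneralLinearGroup K V) :
    Prop :=
  ∀ b v₁ v₂, φ ((X₁ b : V₁ →ₗ[K] V₁) v₁, (X₂ b : V₂ →ₗ[K] V₂) v₂) = (X b : V →ₗ[K] V) (φ (v₁, v₂))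

variable {φ : (V₁ × V₂) ≃ₗ[K] V} {X₁ : B →* LinearMap.GeneralLinearGroup K V₁}
  {X₂ : B →* LinearMap.GeneralLinearGroup K V₂} {X : B →* LinearMap.GeneralLinearGroup K V}

theorem IsSum.eq_conj (h : IsSum φ X₁ X₂ X) : X = conjHom φ (prodHom X₁ X₂) := by
  refine MonoidHom.ext fun b => Units.ext (LinearMap.ext fun v => ?_)
  rw [conjHom_apply, prodHom_apply, h b, Prod.mk.eta, φ.apply_symm_apply]

theorem isSum_conj : IsSum φ X₁ X₂ (conjHom φ (prodHom X₁ X₂)) := by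
  intro b v₁ v₂
  rw [conjHom_apply, prodHom_apply, φ.symm_apply_apply]

theorem IsSum.inl (h : IsSum φ X₁ X₂ X) (b : B) (v : V₁) :
    (φ.toLinearMap ∘ₗ LinearMap.inl K V₁ V₂) ((X₁ b : V₁ →ₗ[K] V₁) v) =
      (X b : V →ₗ[K] V) ((φ.toLinearMap ∘ₗ LinearMap.inl K V₁ V₂) v) := by
  have := h b v 0
  rwa [map_zero] at this

theorem IsSum.inr (h : IsSum φ X₁ X₂ X) (b : B) (v : V₂) :
    (φ.toLinearMap ∘ₗ LinearMap.inr K V₁ V₂) ((X₂ b : V₂ →ₗ[K] V₂) v) =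
      (X b : V →ₗ[K] V) ((φ.toLinearMap ∘ₗ LinearMap.inr K V₁ V₂) v) := by
  have := h b 0 v
  rwa [map_zero] at this

theorem IsSum.aeval_inl (h : IsSum φ X₁ X₂ X) (t : B) (p : K[X]) (v : V₁) :
    Polynomial.aeval (X t : Module.End K V) p (φ (v, 0)) =
      φ (Polynomial.aeval (X₁ t : Module.End K V₁) p v, 0) :=
  (aeval_intertwine (φ.toLinearMap ∘ₗ LinearMap.inl K V₁ V₂) (h.inl t) p v).symm

theorem IsSum.aeval_inr (h : IsSum φ X₁ X₂ X) (t : B) (p : K[X]) (v : V₂) :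
    Polynomial.aeval (X t : Module.End K V) p (φ (0, v)) =
      φ (0, Polynomial.aeval (X₂ t : Module.End K V₂) p v) :=
  (aeval_intertwine (φ.toLinearMap ∘ₗ LinearMap.inr K V₁ V₂) (h.inr t) p v).symm

theorem apply_eq_add (φ : (V₁ × V₂) ≃ₗ[K] V) (v₁ : V₁) (v₂ : V₂) :
    φ (v₁, v₂) = φ (v₁, 0) + φ (0, v₂) := by
  rw [← map_add, Prod.mk_add_mk, add_zero, zero_add]

theorem IsSum.aeval_mul (h : IsSum φ X₁ X₂ X) {t : B} {h₁ h₂ : K[X]}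
    (e₁ : Polynomial.aeval (X₁ t : Module.End K V₁) h₁ = 0)
    (e₂ : Polynomial.aeval (X₂ t : Module.End K V₂) h₂ = 0) :
    Polynomial.aeval (X t : Module.End K V) (h₁ * h₂) = 0 := by
  refine LinearMap.ext fun v => ?_
  obtain ⟨⟨v₁, v₂⟩, rfl⟩ := φ.surjective v
  rw [apply_eq_add, map_add, h.aeval_inl, h.aeval_inr, map_mul, map_mul, e₁, e₂]
  simp [map_zero φ, ← Prod.zero_eq_mk]

theorem aeval_bezout {p₁ p₂ a b : K[X]} (hab : a * p₁ + b * p₂ = 1) {g : Module.End K V}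
    (hg : Polynomial.aeval g p₁ = 0) : Polynomial.aeval g (b * p₂) = 1 := by
  have := congrArg (Polynomial.aeval g) hab
  rwa [map_add, map_mul, hg, mul_zero, zero_add, map_one] at this

theorem IsSum.mem_of_mem (h : IsSum φ X₁ X₂ X) {t : B} {h₁ h₂ : K[X]} (hc : IsCoprime h₁ h₂)
    (e₁ : Polynomial.aeval (X₁ t : Module.End K V₁) h₁ = 0)
    (e₂ : Polynomial.aeval (X₂ t : Module.End K V₂) h₂ = 0) {U : Submodule K V}
    (hU : U ∈ invSub X) {v₁ : V₁} {v₂ : V₂} (hv : φ (v₁, v₂) ∈ U) : φ (v₁, 0) ∈ U := by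
  obtain ⟨a, b, hab⟩ := hc
  have := aeval_mem_of_mem_invSub hU t (b * h₂) hv
  rw [apply_eq_add, map_add, h.aeval_inl, h.aeval_inr, aeval_bezout hab e₁, map_mul, e₂] at this
  simpa [← Prod.zero_eq_mk] using this

theorem IsSum.weight_eq [Finite V₁] [Finite V₂] (h : IsSum φ X₁ X₂ X) {t : B} {h₁ h₂ : K[X]}
    (hc : IsCoprime h₁ h₂) (e₁ : Polynomial.aeval (X₁ t : Module.End K V₁) h₁ = 0)
    (e₂ : Polynomial.aeval (X₂ t : Module.End K V₂) h₂ = 0) :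
    weight X = weight X₁ * weight X₂ := by
  rw [weight, weight, weight, ← moebius_prod]
  symm
  refine moebius_congr
    { toFun := fun S => ⟨(S.1.1.prod S.2.1).map φ.toLinearMap, ?_⟩
      invFun := fun U => (⟨U.1.comap (φ.toLinearMap ∘ₗ LinearMap.inl K V₁ V₂), ?_⟩,
        ⟨U.1.comap (φ.toLinearMap ∘ₗ LinearMap.inr K V₁ V₂), ?_⟩)
      left_inv := ?_
      right_inv := ?_
      map_rel_iff' := ?_ }
  · rintro b _ ⟨⟨v₁, v₂⟩, hv, rfl⟩
    exact ⟨_, ⟨S.1.2 b v₁ hv.1, S.2.2 b v₂ hv.2⟩, h b v₁ v₂⟩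
  · intro b v hv
    rw [Submodule.mem_comap] at hv ⊢
    rw [h.inl]
    exact U.2 b _ hv
  · intro b v hv
    rw [Submodule.mem_comap] at hv ⊢
    rw [h.inr]
    exact U.2 b _ hv
  · rintro ⟨⟨S₁, hS₁⟩, ⟨S₂, hS₂⟩⟩
    ext v <;> simp
  · rintro ⟨U, hU⟩
    ext v
    simp only [Submodule.mem_map]
    constructor
    · rintro ⟨⟨v₁, v₂⟩, hv, rfl⟩
      have := U.add_mem hv.1 hv.2
      simpa [← map_add] using this
    · intro hv
      obtain ⟨⟨v₁, v₂⟩, rfl⟩ := φ.surjective v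
      have h1 := h.mem_of_mem hc e₁ e₂ hU hv
      have h2 : φ (0, v₂) ∈ U := by
        have := U.sub_mem hv h1
        rwa [apply_eq_add φ v₁ v₂, add_sub_cancel_left] at this
      exact ⟨(v₁, v₂), ⟨h1, h2⟩, rfl⟩
  · rintro ⟨⟨S₁, hS₁⟩, ⟨S₂, hS₂⟩⟩ ⟨⟨T₁, hT₁⟩, ⟨T₂, hT₂⟩⟩
    change (S₁.prod S₂).map φ.toLinearMap ≤ (T₁.prod T₂).map φ.toLinearMap ↔ S₁ ≤ T₁ ∧ S₂ ≤ T₂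
    rw [Submodule.map_le_map_iff_of_injective (f := φ.toLinearMap) φ.injective]
    constructor
    · intro hle
      exact ⟨fun v hv => (hle (show (v, (0 : V₂)) ∈ S₁.prod S₂ from ⟨hv, S₂.zero_mem⟩)).1,
        fun v hv => (hle (show ((0 : V₁), v) ∈ S₁.prod S₂ from ⟨S₁.zero_mem, hv⟩)).2⟩
    · exact fun hle => Submodule.prod_mono hle.1 hle.2

theorem isCompl_ker_aeval {h₁ h₂ : K[X]} (hc : IsCoprime h₁ h₂) {g : Module.End K V}
    (hg : Polynomial.aeval g (h₁ * h₂) = 0) :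
    IsCompl (LinearMap.ker (Polynomial.aeval g h₁)) (LinearMap.ker (Polynomial.aeval g h₂)) := by
  refine ⟨Polynomial.disjoint_ker_aeval_of_isCoprime g hc, codisjoint_iff.2 ?_⟩
  rw [Polynomial.sup_ker_aeval_eq_ker_aeval_mul_of_coprime g hc, hg, LinearMap.ker_zero]

theorem aeval_restrictHom_ker {t : B} {p : K[X]}
    (hU : LinearMap.ker (Polynomial.aeval (X t : Module.End K V) p) ∈ invSub X) :
    Polynomial.aeval (restrictHom X hU t : Module.End K (LinearMap.ker
      (Polynomial.aeval (X t : Module.End K V) p))) p = 0 := by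
  refine LinearMap.ext fun v => Subtype.ext ?_
  have := aeval_intertwine (Submodule.subtype _) (g := (restrictHom X hU t : Module.End K (LinearMap.ker
      (Polynomial.aeval (X t : Module.End K V) p))))
    (g' := (X t : Module.End K V)) (fun v => rfl) p v
  exact this.trans v.2

theorem aeval_conjHom (φ : V₁ ≃ₗ[K] V) {t : B} {p : K[X]}
    (h : Polynomial.aeval (X₁ t : Module.End K V₁) p = 0) :
    Polynomial.aeval (conjHom φ X₁ t : Module.End K V) p = 0 := by
  refine LinearMap.ext fun v => ?_
  have := aeval_intertwine φ.toLinearMap (g := (X₁ t : Module.End K V₁))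
    (g' := (conjHom φ X₁ t : Module.End K V)) (fun v => by simp) p (φ.symm v)
  rw [h] at this
  simpa using this.symm

variable [Module.Finite K V] [Module.Finite K V₁] [Module.Finite K V₂]

theorem card_isSum {t : B} (ht : ∀ b, Commute b t) {h₁ h₂ : K[X]} (hc : IsCoprime h₁ h₂)
    (hX : Polynomial.aeval (X t : Module.End K V) (h₁ * h₂) = 0)
    (hd : Module.finrank K V = Module.finrank K V₁ + Module.finrank K V₂)
    (hk : Module.finrank K (LinearMap.ker (Polynomial.aeval (X t : Module.End K V) h₁)) =
      Module.finrank K V₁) :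
    Nat.card {z : ((V₁ × V₂) ≃ₗ[K] V) ×
        {X : B →* LinearMap.GeneralLinearGroup K V₁ //
          Polynomial.aeval (X t : Module.End K V₁) h₁ = 0} ×
        {X : B →* LinearMap.GeneralLinearGroup K V₂ //
          Polynomial.aeval (X t : Module.End K V₂) h₂ = 0} // IsSum z.1 z.2.1.1 z.2.2.1 X} =
      Nat.card (LinearMap.GeneralLinearGroup K V₁) *
        Nat.card (LinearMap.GeneralLinearGroup K V₂) := by
  set U₁ := LinearMap.ker (Polynomial.aeval (X t : Module.End K V) h₁) with hU₁
  set U₂ := LinearMap.ker (Polynomial.aeval (X t : Module.End K V) h₂) with hU₂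
  have hcompl : IsCompl U₁ U₂ := isCompl_ker_aeval hc hX
  have hk2 : Module.finrank K U₂ = Module.finrank K V₂ := by
    have := Submodule.finrank_add_eq_of_isCompl hcompl
    omega
  have hi₁ : U₁ ∈ invSub X := ker_aeval_mem_invSub X ht h₁
  have hi₂ : U₂ ∈ invSub X := ker_aeval_mem_invSub X ht h₂
  rw [← card_linearEquiv (LinearEquiv.ofFinrankEq V₁ U₁ hk.symm),
    ← card_linearEquiv (LinearEquiv.ofFinrankEq V₂ U₂ hk2.symm), ← Nat.card_prod]
  symm
  have hφ : ∀ (ψ₁ : V₁ ≃ₗ[K] U₁) (ψ₂ : V₂ ≃ₗ[K] U₂) (v₁ : V₁) (v₂ : V₂),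
      ((ψ₁.prodCongr ψ₂).trans (Submodule.prodEquivOfIsCompl U₁ U₂ hcompl)) (v₁, v₂) =
        ψ₁ v₁ + ψ₂ v₂ := fun ψ₁ ψ₂ v₁ v₂ => rfl
  refine Nat.card_congr (Equiv.ofBijective (fun ψ =>
    ⟨((ψ.1.prodCongr ψ.2).trans (Submodule.prodEquivOfIsCompl U₁ U₂ hcompl),
      ⟨conjHom ψ.1.symm (restrictHom X hi₁), aeval_conjHom _ (aeval_restrictHom_ker hi₁)⟩,
      ⟨conjHom ψ.2.symm (restrictHom X hi₂), aeval_conjHom _ (aeval_restrictHom_ker hi₂)⟩),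
      ?_⟩) ⟨?_, ?_⟩)
  · intro b v₁ v₂
    rw [hφ, hφ]
    simp
  · rintro ⟨ψ₁, ψ₂⟩ ⟨ψ₁', ψ₂'⟩ h
    have h1 := congrArg (fun z => z.1.1) h
    refine Prod.ext (LinearEquiv.ext fun v => Subtype.ext ?_)
      (LinearEquiv.ext fun v => Subtype.ext ?_)
    · have := LinearEquiv.congr_fun h1 (v, 0)
      simpa [hφ] using this
    · have := LinearEquiv.congr_fun h1 (0, v)
      simpa [hφ] using this
  · rintro ⟨⟨φ, ⟨X₁, e₁⟩, ⟨X₂, e₂⟩⟩, h⟩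
    change IsSum φ X₁ X₂ X at h
    set f₁ : V₁ →ₗ[K] U₁ := (φ.toLinearMap ∘ₗ LinearMap.inl K V₁ V₂).codRestrict U₁ (fun v => by
      rw [hU₁, LinearMap.mem_ker]
      refine (h.aeval_inl t h₁ v).trans ?_
      rw [e₁]; simp) with hf₁
    set f₂ : V₂ →ₗ[K] U₂ := (φ.toLinearMap ∘ₗ LinearMap.inr K V₁ V₂).codRestrict U₂ (fun v => by
      rw [hU₂, LinearMap.mem_ker]
      refine (h.aeval_inr t h₂ v).trans ?_
      rw [e₂]; simp) with hf₂
    have hinj₁ : Function.Injective f₁ := fun v w hvw => by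
      have := φ.injective (congrArg Subtype.val hvw)
      exact congrArg Prod.fst this
    have hinj₂ : Function.Injective f₂ := fun v w hvw => by
      have := φ.injective (congrArg Subtype.val hvw)
      exact congrArg Prod.snd this
    set ψ₁ := LinearEquiv.ofInjectiveOfFinrankEq f₁ hinj₁ hk.symm with hψ₁
    set ψ₂ := LinearEquiv.ofInjectiveOfFinrankEq f₂ hinj₂ hk2.symm with hψ₂
    have a₁ : ∀ v, (ψ₁ v : V) = φ (v, 0) := fun v => rfl
    have a₂ : ∀ v, (ψ₂ v : V) = φ (0, v) := fun v => rfl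
    refine ⟨(ψ₁, ψ₂), Subtype.ext (Prod.ext ?_ (Prod.ext (Subtype.ext ?_) (Subtype.ext ?_)))⟩
    · refine LinearEquiv.ext fun v => ?_
      obtain ⟨v₁, v₂⟩ := v
      change ((ψ₁.prodCongr ψ₂).trans (Submodule.prodEquivOfIsCompl U₁ U₂ hcompl)) (v₁, v₂) = _
      rw [hφ, a₁, a₂, ← apply_eq_add]
    · refine MonoidHom.ext fun b => Units.ext (LinearMap.ext fun v => ?_)
      change (conjHom ψ₁.symm (restrictHom X hi₁) b : V₁ →ₗ[K] V₁) v = (X₁ b : V₁ →ₗ[K] V₁) v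
      rw [conjHom_apply, LinearEquiv.symm_symm, LinearEquiv.symm_apply_eq]
      refine Subtype.ext ?_
      rw [coe_restrictHom_apply, a₁, a₁]
      exact (h.inl b v).symm
    · refine MonoidHom.ext fun b => Units.ext (LinearMap.ext fun v => ?_)
      change (conjHom ψ₂.symm (restrictHom X hi₂) b : V₂ →ₗ[K] V₂) v = (X₂ b : V₂ →ₗ[K] V₂) v
      rw [conjHom_apply, LinearEquiv.symm_symm, LinearEquiv.symm_apply_eq]
      refine Subtype.ext ?_
      rw [coe_restrictHom_apply, a₂, a₂]
      exact (h.inr b v).symm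

end Split

section SplitSum

variable {B K V V₁ V₂ : Type*} [Group B] [Field K] [AddCommGroup V] [Module K V]
  [AddCommGroup V₁] [Module K V₁] [AddCommGroup V₂] [Module K V₂]

theorem finsum_prod_mul {Z Ω₁ Ω₂ : Type*} [Finite Z] [Finite Ω₁] [Finite Ω₂] (f : Ω₁ → ℚ)
    (g : Ω₂ → ℚ) : ∑ᶠ z : Z × Ω₁ × Ω₂, f z.2.1 * g z.2.2 =
      Nat.card Z * ((∑ᶠ x, f x) * ∑ᶠ y, g y) := by
  have := Fintype.ofFinite Z
  have := Fintype.ofFinite Ω₁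
  have := Fintype.ofFinite Ω₂
  simp only [finsum_eq_sum_of_fintype, Fintype.sum_prod_type, Finset.sum_mul_sum,
    Finset.sum_const, Finset.card_univ, nsmul_eq_mul, Nat.card_eq_fintype_card]

theorem finsum_weight_split [Finite K] [Module.Finite K V] [Module.Finite K V₁]
    [Module.Finite K V₂]
    [Finite (B →* LinearMap.GeneralLinearGroup K V)]
    [Finite (B →* LinearMap.GeneralLinearGroup K V₁)]
    [Finite (B →* LinearMap.GeneralLinearGroup K V₂)] {t : B} (ht : ∀ b, Commute b t)
    {h₁ h₂ : K[X]} (hc : IsCoprime h₁ h₂)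
    (hd : Module.finrank K V = Module.finrank K V₁ + Module.finrank K V₂) {a : ℕ}
    (ha : Module.finrank K V₁ = a) :
    (∑ᶠ X : {X : {X : B →* LinearMap.GeneralLinearGroup K V //
        Polynomial.aeval (X t : Module.End K V) (h₁ * h₂) = 0} //
        Module.finrank K (LinearMap.ker (Polynomial.aeval (X.1 t : Module.End K V) h₁)) =
          a}, (weight X.1.1 : ℚ)) /
      Nat.card (LinearMap.GeneralLinearGroup K V) = eulerMass V₁ t h₁ * eulerMass V₂ t h₂ := by
  subst ha
  have : Finite V := Module.finite_of_finite K
  have : Finite V₁ := Module.finite_of_finite K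
  have : Finite V₂ := Module.finite_of_finite K
  have : Finite ((V₁ × V₂) ≃ₗ[K] V) := DFunLike.finite _
  have e : (V₁ × V₂) ≃ₗ[K] V := LinearEquiv.ofFinrankEq _ _ (by rw [Module.finrank_prod, hd])
  have key := card_fiber_mul_finsum
    (fun (z : ((V₁ × V₂) ≃ₗ[K] V) ×
        {X : B →* LinearMap.GeneralLinearGroup K V₁ //
          Polynomial.aeval (X t : Module.End K V₁) h₁ = 0} ×
        {X : B →* LinearMap.GeneralLinearGroup K V₂ //
          Polynomial.aeval (X t : Module.End K V₂) h₂ = 0})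
      (X : {X : {X : B →* LinearMap.GeneralLinearGroup K V //
        Polynomial.aeval (X t : Module.End K V) (h₁ * h₂) = 0} //
        Module.finrank K (LinearMap.ker (Polynomial.aeval (X.1 t : Module.End K V) h₁)) =
          Module.finrank K V₁}) => IsSum z.1 z.2.1.1 z.2.2.1 X.1.1)
    (fun X => (weight X.1.1 : ℚ)) (fun z => (weight z.2.1.1 : ℚ) * (weight z.2.2.1 : ℚ))
    (Nat.card (LinearMap.GeneralLinearGroup K V₁) *
        Nat.card (LinearMap.GeneralLinearGroup K V₂)) ?_ ?_ ?_
  · rw [finsum_prod_mul (fun X : {X : B →* LinearMap.GeneralLinearGroup K V₁ //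
          Polynomial.aeval (X t : Module.End K V₁) h₁ = 0} => (weight X.1 : ℚ))
          (fun X : {X : B →* LinearMap.GeneralLinearGroup K V₂ //
          Polynomial.aeval (X t : Module.End K V₂) h₂ = 0} => (weight X.1 : ℚ)),
          card_linearEquiv' e] at key
    have c0 : (Nat.card (LinearMap.GeneralLinearGroup K V) : ℚ) ≠ 0 := by
      exact_mod_cast Nat.card_pos.ne'
    have c1 : (Nat.card (LinearMap.GeneralLinearGroup K V₁) : ℚ) ≠ 0 := by
      exact_mod_cast Nat.card_pos.ne'
    have c2 : (Nat.card (LinearMap.GeneralLinearGroup K V₂) : ℚ) ≠ 0 := by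
      exact_mod_cast Nat.card_pos.ne'
    rw [eulerMass, eulerMass, div_mul_div_comm, div_eq_div_iff c0 (mul_ne_zero c1 c2)]
    push_cast at key
    linear_combination key
  · rintro ⟨φ, ⟨X₁, e₁⟩, ⟨X₂, e₂⟩⟩
    have hs : IsSum φ X₁ X₂ (conjHom φ (prodHom X₁ X₂)) := isSum_conj
    refine ⟨⟨⟨conjHom φ (prodHom X₁ X₂), hs.aeval_mul e₁ e₂⟩, ?_⟩, hs, ?_⟩
    · have : LinearMap.ker (Polynomial.aeval
          (conjHom φ (prodHom X₁ X₂) t : Module.End K V) h₁) =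
          LinearMap.range (φ.toLinearMap ∘ₗ LinearMap.inl K V₁ V₂) := by
        ext v
        rw [LinearMap.mem_ker, LinearMap.mem_range]
        constructor
        · intro hv
          obtain ⟨⟨v₁, v₂⟩, rfl⟩ := φ.surjective v
          refine ⟨v₁, ?_⟩
          rw [apply_eq_add, map_add, hs.aeval_inl, hs.aeval_inr, e₁, LinearMap.zero_apply,
            ← Prod.zero_eq_mk, map_zero, zero_add, LinearEquiv.map_eq_zero_iff] at hv
          obtain ⟨a, b, hab⟩ := hc
          have h1 := aeval_bezout ((add_comm _ _).trans hab) e₂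
          have h2 : v₂ = 0 := by
            have h3 := LinearMap.congr_fun h1 v₂
            rw [map_mul, Module.End.mul_apply, (Prod.mk.inj hv).2, map_zero] at h3
            exact h3.symm
          rw [h2]; rfl
        · rintro ⟨v₁, rfl⟩
          refine (hs.aeval_inl t h₁ v₁).trans ?_
          rw [e₁, LinearMap.zero_apply, ← Prod.zero_eq_mk, map_zero]
      change Module.finrank K (LinearMap.ker (Polynomial.aeval
          (conjHom φ (prodHom X₁ X₂) t : Module.End K V) h₁)) = _
      rw [this]
      refine LinearMap.finrank_range_of_inj fun v w hvw => ?_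
      exact congrArg Prod.fst (φ.injective hvw)
    · rintro ⟨⟨X, hX⟩, hX'⟩ h
      exact Subtype.ext (Subtype.ext (IsSum.eq_conj h))
  · rintro ⟨φ, ⟨X₁, e₁⟩, ⟨X₂, e₂⟩⟩ ⟨⟨X, hX⟩, hX'⟩ h
    exact_mod_cast IsSum.weight_eq h hc e₁ e₂
  · rintro ⟨⟨X, hX⟩, hX'⟩
    exact card_isSum ht hc hX hd hX'

theorem finsum_eq_sum_antidiagonal {Ω : Type*} [Finite Ω] (d : Ω → ℕ) (n : ℕ)
    (hd : ∀ x, d x ≤ n) (w : Ω → ℚ) : ∑ᶠ x, w x =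
      ∑ ij ∈ Finset.HasAntidiagonal.antidiagonal n, ∑ᶠ x : {x // d x = ij.1}, w x.1 := by
  classical
  have := Fintype.ofFinite Ω
  simp only [finsum_eq_sum_of_fintype]
  rw [← Finset.sum_fiberwise_of_maps_to (t := Finset.HasAntidiagonal.antidiagonal n)
    (g := fun x => (d x, n - d x))]
  · refine Finset.sum_congr rfl fun ij hij => Finset.sum_subtype _ (fun x => ?_) w
    rw [Finset.HasAntidiagonal.mem_antidiagonal] at hij
    simp only [Finset.mem_filter, Finset.mem_univ, true_and, Prod.ext_iff]
    exact ⟨fun h => h.1, fun h => ⟨h, by omega⟩⟩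
  · intro x _
    rw [Finset.HasAntidiagonal.mem_antidiagonal]
    exact Nat.add_sub_of_le (hd x)

theorem eulerMass_mul [Finite K] [∀ n : ℕ, Finite (B →* LinearMap.GeneralLinearGroup K (Fin n → K))]
    {t : B} (ht : ∀ b, Commute b t) {h₁ h₂ : K[X]} (hc : IsCoprime h₁ h₂) (n : ℕ) :
    eulerMass (Fin n → K) t (h₁ * h₂) = ∑ ij ∈ Finset.HasAntidiagonal.antidiagonal n,
      eulerMass (Fin ij.1 → K) t h₁ * eulerMass (Fin ij.2 → K) t h₂ := by
  rw [Finset.sum_congr rfl fun ij hij => (finsum_weight_split (V := Fin n → K) ht hc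
    (by simpa using (Finset.HasAntidiagonal.mem_antidiagonal.1 hij).symm)
    (Module.finrank_fin_fun K)).symm, ← Finset.sum_div, eulerMass]
  congr 1
  refine finsum_eq_sum_antidiagonal (fun X : {X : B →* LinearMap.GeneralLinearGroup K (Fin n → K) //
    Polynomial.aeval (X t : Module.End K (Fin n → K)) (h₁ * h₂) = 0} => Module.finrank K
      (LinearMap.ker (Polynomial.aeval (X.1 t : Module.End K (Fin n → K)) h₁))) n (fun X => ?_) _
  exact (Submodule.finrank_le _).trans (Module.finrank_fin_fun K).le

/-- The generating function of the Euler masses of the spaces `K ^ n`. -/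
def massSeries {B K : Type*} [Group B] [Field K] (t : B) (h : K[X]) : ℚ⟦X⟧ :=
  PowerSeries.mk fun n => eulerMass (Fin n → K) t h

theorem massSeries_mul [Finite K]
    [∀ n : ℕ, Finite (B →* LinearMap.GeneralLinearGroup K (Fin n → K))]
    {t : B} (ht : ∀ b, Commute b t) {h₁ h₂ : K[X]} (hc : IsCoprime h₁ h₂) :
    massSeries t (h₁ * h₂) = massSeries t h₁ * massSeries t h₂ := by
  ext n
  simp only [massSeries, PowerSeries.coeff_mk, PowerSeries.coeff_mul]
  exact eulerMass_mul ht hc n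

theorem unit_eq_one_of_subsingleton [Subsingleton V] (g : LinearMap.GeneralLinearGroup K V) :
    g = 1 := Units.ext (Subsingleton.elim _ _)

theorem eulerMass_of_subsingleton [Subsingleton V] (t : B) (h : K[X]) : eulerMass V t h = 1 := by
  have h1 : Unique (LinearMap.GeneralLinearGroup K V) := ⟨⟨1⟩, unit_eq_one_of_subsingleton⟩
  have h2 : Unique {X : B →* LinearMap.GeneralLinearGroup K V //
    Polynomial.aeval (X t : Module.End K V) h = 0} :=
    ⟨⟨⟨1, Subsingleton.elim _ _⟩⟩, fun X => Subtype.ext (MonoidHom.ext fun b =>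
      (unit_eq_one_of_subsingleton _).trans (unit_eq_one_of_subsingleton _).symm)⟩
  rw [eulerMass, finsum_unique, weight_of_subsingleton, Nat.card_unique]
  simp

theorem massSeries_one (t : B) : massSeries t (1 : K[X]) = 1 := by
  ext n
  rw [massSeries, PowerSeries.coeff_mk, PowerSeries.coeff_one]
  rcases eq_or_ne n 0 with rfl | hn
  · rw [if_pos rfl, eulerMass_of_subsingleton]
  · rw [if_neg hn]
    have : NeZero n := ⟨hn⟩
    have : IsEmpty {X : B →* LinearMap.GeneralLinearGroup K (Fin n → K) //
        Polynomial.aeval (X t : Module.End K (Fin n → K)) (1 : K[X]) = 0} :=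
      ⟨fun X => one_ne_zero (α := Module.End K (Fin n → K))
        ((map_one (Polynomial.aeval _)).symm.trans X.2)⟩
    rw [eulerMass, finsum_of_isEmpty, zero_div]

theorem massSeries_prod [Finite K]
    [∀ n : ℕ, Finite (B →* LinearMap.GeneralLinearGroup K (Fin n → K))]
    {t : B} (ht : ∀ b, Commute b t) (S : Finset K[X])
    (hS : (S : Set K[X]).Pairwise IsCoprime) :
    massSeries t (∏ f ∈ S, f) = ∏ f ∈ S, massSeries t f := by
  classical
  induction S using Finset.induction_on with
  | empty => simp [massSeries_one]
  | insert f S hf ih =>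
    rw [Finset.prod_insert hf, Finset.prod_insert hf, massSeries_mul ht, ih]
    · exact hS.mono (by simp)
    · refine IsCoprime.prod_right fun g hg => hS (by simp) (by simp [hg]) ?_
      rintro rfl
      exact hf hg

end SplitSum

/-! ### The Euler mass of an irreducible polynomial -/

section Irreducible

variable {A K L V W : Type*} [Group A] [Field K] [Field L] [AddCommGroup V]
  [Module K V] [AddCommGroup W] [Module K W] [Module L W]

/-- `φ` identifies `X` with the representation `Y`, where the generator of `ℤ` acts by `α`. -/
def IsExtension (α : L) (φ : W ≃ₗ[K] V) (Y : A →* LinearMap.GeneralLinearGroup L W)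
    (X : A × Multiplicative ℤ →* LinearMap.GeneralLinearGroup K V) : Prop :=
  ∀ a (z : ℤ) w, φ ((Y a : W →ₗ[L] W) (α ^ z • w)) =
    (X (a, Multiplicative.ofAdd z) : V →ₗ[K] V) (φ w)

/-- The generator of the factor `ℤ`. -/
abbrev intGen (A : Type*) [Group A] : A × Multiplicative ℤ := (1, Multiplicative.ofAdd 1)

theorem commute_intGen (b : A × Multiplicative ℤ) : Commute b (intGen A) :=
  Prod.ext (by simp) (mul_comm _ _)

theorem eq_mul_intGen_zpow (a : A) (z : ℤ) :
    ((a, Multiplicative.ofAdd z) : A × Multiplicative ℤ) = (a, 1) * intGen A ^ z := by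
  refine Prod.ext (by simp) ?_
  rw [Prod.snd_mul, Prod.pow_snd, ← ofAdd_zsmul]
  simp

variable {α : L} {φ : W ≃ₗ[K] V} {Y : A →* LinearMap.GeneralLinearGroup L W}
  {X : A × Multiplicative ℤ →* LinearMap.GeneralLinearGroup K V}

theorem IsExtension.apply_gen (h : IsExtension α φ Y X) (w : W) :
    φ (α • w) = (X (intGen A) : V →ₗ[K] V) (φ w) := by
  have := h 1 1 w
  simpa using this

variable [Algebra K L] [IsScalarTower K L W]

theorem aeval_lsmul_apply (α : L) (p : K[X]) (w : W) :
    Polynomial.aeval (Algebra.lsmul K K W α) p w = Polynomial.aeval α p • w := by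
  rw [Polynomial.aeval_algHom_apply]
  rfl

theorem map_smul_of_map_gen_smul [Module L V] [IsScalarTower K L V] (pb : PowerBasis K L)
    (φ : W →ₗ[K] V) (h : ∀ w, φ (pb.gen • w) = pb.gen • φ w) (l : L) (w : W) :
    φ (l • w) = l • φ w := by
  obtain ⟨p, rfl⟩ := pb.exists_eq_aeval' l
  rw [← aeval_lsmul_apply, ← aeval_lsmul_apply]
  exact aeval_intertwine φ (g := Algebra.lsmul K K W pb.gen) (g' := Algebra.lsmul K K V pb.gen)
    h p w

/-- The representation of `A × ℤ` on `V` obtained from `Y` and `α` by transport along `φ`. -/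
def extendHom (hα : α ≠ 0) (φ : W ≃ₗ[K] V) (Y : A →* LinearMap.GeneralLinearGroup L W) :
    A × Multiplicative ℤ →* LinearMap.GeneralLinearGroup K V :=
  MonoidHom.toHomUnits
    { toFun := fun b => φ.toLinearMap ∘ₗ ((Y b.1 : W →ₗ[L] W).restrictScalars K ∘ₗ
        Algebra.lsmul K K W (α ^ b.2.toAdd)) ∘ₗ φ.symm.toLinearMap
      map_one' := by ext; simp
      map_mul' := fun a b => by
        ext v
        simp [zpow_add₀ hα] }

theorem isExtension_extendHom (hα : α ≠ 0) : IsExtension α φ Y (extendHom hα φ Y) := by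
  intro a z w
  change _ = φ ((Y a : W →ₗ[L] W) (α ^ z • φ.symm (φ w)))
  rw [φ.symm_apply_apply]

theorem IsExtension.eq_extendHom (h : IsExtension α φ Y X) (hα : α ≠ 0) :
    X = extendHom hα φ Y := by
  refine MonoidHom.ext fun b => Units.ext (LinearMap.ext fun v => ?_)
  obtain ⟨w, rfl⟩ := φ.surjective v
  exact (h b.1 b.2.toAdd w).symm.trans (isExtension_extendHom hα b.1 b.2.toAdd w)

theorem IsExtension.aeval_apply (h : IsExtension α φ Y X) (p : K[X]) (w : W) :
    Polynomial.aeval (X (intGen A) : Module.End K V) p (φ w) = φ (Polynomial.aeval α p • w) := by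
  rw [← aeval_lsmul_apply]
  exact (aeval_intertwine φ.toLinearMap (g := Algebra.lsmul K K W α) h.apply_gen p w).symm

theorem IsExtension.aeval_minpoly (h : IsExtension α φ Y X) :
    Polynomial.aeval (X (intGen A) : Module.End K V) (minpoly K α) = 0 := by
  refine LinearMap.ext fun v => ?_
  obtain ⟨w, rfl⟩ := φ.surjective v
  rw [h.aeval_apply, minpoly.aeval, zero_smul, map_zero, LinearMap.zero_apply]

theorem IsExtension.weight_eq {pb : PowerBasis K L} (h : IsExtension pb.gen φ Y X) :
    weight X = weight Y := by
  symm
  refine moebius_congr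
    { toFun := fun S => ⟨(S.1.restrictScalars K).map φ.toLinearMap, ?_⟩
      invFun := fun U => ⟨
        { toAddSubmonoid := (U.1.comap φ.toLinearMap).toAddSubmonoid
          smul_mem' := ?_ }, ?_⟩
      left_inv := ?_
      right_inv := ?_
      map_rel_iff' := ?_ }
  · rintro b _ ⟨w, hw, rfl⟩
    exact ⟨_, S.2 b.1 _ (S.1.smul_mem (pb.gen ^ b.2.toAdd) hw), h b.1 b.2.toAdd w⟩
  · intro l w hw
    obtain ⟨p, rfl⟩ := pb.exists_eq_aeval' l
    change φ _ ∈ U.1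
    rw [← h.aeval_apply]
    exact aeval_mem_of_mem_invSub U.2 _ p hw
  · intro a w hw
    change φ _ ∈ U.1
    have := h a 0 w
    rw [zpow_zero, one_smul] at this
    rw [this]
    exact U.2 _ _ hw
  · rintro ⟨S, hS⟩
    refine Subtype.ext (SetLike.ext fun w => ?_)
    change φ w ∈ (S.restrictScalars K).map φ.toLinearMap ↔ _
    constructor
    · rintro ⟨w', hw', he⟩
      exact φ.injective he ▸ hw'
    · exact fun hw => ⟨w, hw, rfl⟩
  · rintro ⟨U, hU⟩
    refine Subtype.ext (SetLike.ext fun v => ?_)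
    constructor
    · rintro ⟨w, hw, rfl⟩
      exact hw
    · intro hv
      obtain ⟨w, rfl⟩ := φ.surjective v
      exact ⟨w, hv, rfl⟩
  · rintro ⟨S, hS⟩ ⟨T, hT⟩
    exact Submodule.map_le_map_iff_of_injective (f := φ.toLinearMap) φ.injective _ _

theorem card_isExtension [Module L V] [IsScalarTower K L V] [Finite L] [Finite W]
    (pb : PowerBasis K L) (hα : pb.gen ≠ 0)
    (hX : ∀ v : V, (X (intGen A) : V →ₗ[K] V) v = pb.gen • v) (e : W ≃ₗ[L] V) :
    Nat.card {z : (W ≃ₗ[K] V) × (A →* LinearMap.GeneralLinearGroup L W) //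
      IsExtension pb.gen z.1 z.2 X} = Nat.card (LinearMap.GeneralLinearGroup L W) := by
  rw [← card_linearEquiv e]
  symm
  have hpow : ∀ (z : ℤ) (v : V), (X (intGen A ^ z) : V →ₗ[K] V) v = pb.gen ^ z • v := by
    intro z
    have h1 : X (intGen A) =
        Units.map ((Algebra.lsmul K K V : L →ₐ[K] Module.End K V) : L →* Module.End K V)
          (Units.mk0 pb.gen hα) :=
      Units.ext (LinearMap.ext hX)
    intro v
    rw [map_zpow, h1, ← map_zpow]
    change ((Units.mk0 pb.gen hα ^ z : Lˣ) : L) • v = _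
    rw [Units.val_zpow_eq_zpow_val, Units.val_mk0]
  have hlin : ∀ (a : A) (l : L) (v : V), (X (a, 1) : V →ₗ[K] V) (l • v) =
      l • (X (a, 1) : V →ₗ[K] V) v := by
    intro a l v
    refine map_smul_of_map_gen_smul pb (X (a, 1) : V →ₗ[K] V) (fun v => ?_) l v
    rw [← hX, ← hX]
    have := congrArg (fun g : LinearMap.GeneralLinearGroup K V => (g : V →ₗ[K] V) v)
      ((commute_intGen (a, 1)).map X).eq
    exact this
  let XL : A →* LinearMap.GeneralLinearGroup L V := MonoidHom.toHomUnits
    { toFun := fun a =>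
        { toFun := (X (a, 1) : V →ₗ[K] V)
          map_add' := map_add _
          map_smul' := hlin a }
      map_one' := by
        ext v
        change (X 1 : V →ₗ[K] V) v = v
        simp
      map_mul' := fun a b => by
        ext v
        change (X (a * b, 1) : V →ₗ[K] V) v = (X (a, 1) : V →ₗ[K] V) ((X (b, 1) : V →ₗ[K] V) v)
        rw [show ((a * b, 1) : A × Multiplicative ℤ) = (a, 1) * (b, 1) by simp, map_mul]
        rfl }
  have hXL : ∀ a v, (XL a : V →ₗ[L] V) v = (X (a, 1) : V →ₗ[K] V) v := fun _ _ => rfl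
  refine Nat.card_congr (Equiv.ofBijective
    (fun ψ => ⟨(ψ.restrictScalars K, conjHom ψ.symm XL), ?_⟩) ⟨?_, ?_⟩)
  · intro a z w
    change ψ _ = (X (a, Multiplicative.ofAdd z) : V →ₗ[K] V) (ψ w)
    rw [conjHom_apply, LinearEquiv.symm_symm, ψ.apply_symm_apply, hXL, map_smul, ← hpow,
      eq_mul_intGen_zpow, map_mul]
    rfl
  · intro ψ ψ' h
    have := congrArg (fun z => z.1.1) h
    exact LinearEquiv.ext fun w => LinearEquiv.congr_fun this w
  · rintro ⟨⟨φ, Y⟩, h⟩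
    change IsExtension pb.gen φ Y X at h
    have hφ : ∀ (l : L) (w : W), φ (l • w) = l • φ w := fun l w =>
      map_smul_of_map_gen_smul pb φ.toLinearMap
        (fun w => (h.apply_gen w).trans (hX _)) l w
    let ψ : W ≃ₗ[L] V := { φ with map_smul' := hφ }
    refine ⟨ψ, Subtype.ext (Prod.ext (LinearEquiv.ext fun w => rfl) ?_)⟩
    refine MonoidHom.ext fun a => Units.ext (LinearMap.ext fun w => ?_)
    change (conjHom ψ.symm XL a : W →ₗ[L] W) w = _
    rw [conjHom_apply, LinearEquiv.symm_symm, LinearEquiv.symm_apply_eq, hXL]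
    have := h a 0 w
    rw [zpow_zero, one_smul] at this
    exact this.symm

/-- A representation annihilated by the minimal polynomial of `pb.gen` makes `V` a vector space
over `L`. -/
theorem exists_module_of_aeval_minpoly (pb : PowerBasis K L)
    {g : Module.End K V} (hg : Polynomial.aeval g (minpoly K pb.gen) = 0) :
    ∃ (_ : Module L V), IsScalarTower K L V ∧ ∀ v : V, g v = pb.gen • v := by
  let ρ : L →ₐ[K] Module.End K V := pb.lift g hg
  let m : Module L V := Module.compHom V (ρ : L →+* Module.End K V)
  have hm : ∀ (l : L) (v : V), l • v = ρ l v := fun _ _ => rfl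
  refine ⟨m, ⟨fun k l v => ?_⟩, fun v => ?_⟩
  · rw [hm, hm, map_smul]
    rfl
  · rw [hm, PowerBasis.lift_gen]

theorem eulerMass_minpoly [Finite K] [Finite L] [Module.Finite K V] [Finite W]
    [Finite (A × Multiplicative ℤ →* LinearMap.GeneralLinearGroup K V)]
    [Finite (A →* LinearMap.GeneralLinearGroup L W)]
    (pb : PowerBasis K L) (hα : pb.gen ≠ 0)
    (hd : Module.finrank K V = Module.finrank K L * Module.finrank L W) :
    eulerMass V (intGen A) (minpoly K pb.gen) =
      (∑ᶠ Y : A →* LinearMap.GeneralLinearGroup L W, (weight Y : ℚ)) /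
        Nat.card (LinearMap.GeneralLinearGroup L W) := by
  have : Finite V := Module.finite_of_finite K
  have : Module.Finite K L := pb.finite
  have : Module.Finite L W := Module.Finite.of_finite
  have : Module.Finite K W := Module.Finite.of_finite
  have : Finite (W ≃ₗ[K] V) := DFunLike.finite _
  have e : W ≃ₗ[K] V := LinearEquiv.ofFinrankEq _ _ (by
    rw [hd, Module.finrank_mul_finrank K L W])
  have key := card_fiber_mul_finsum
    (fun (z : (W ≃ₗ[K] V) × (A →* LinearMap.GeneralLinearGroup L W))
      (X : {X : A × Multiplicative ℤ →* LinearMap.GeneralLinearGroup K V //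
        Polynomial.aeval (X (intGen A) : Module.End K V) (minpoly K pb.gen) = 0}) =>
        IsExtension pb.gen z.1 z.2 X.1)
    (fun X => (weight X.1 : ℚ)) (fun z => (weight z.2 : ℚ))
    (Nat.card (LinearMap.GeneralLinearGroup L W)) ?_ ?_ ?_
  · have h1 := finsum_prod_mul (Z := W ≃ₗ[K] V) (Ω₂ := Unit)
      (fun Y : A →* LinearMap.GeneralLinearGroup L W => (weight Y : ℚ)) (fun _ => 1)
    have h2 : ∑ᶠ z : (W ≃ₗ[K] V) × (A →* LinearMap.GeneralLinearGroup L W), (weight z.2 : ℚ) =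
        ∑ᶠ z : (W ≃ₗ[K] V) × (A →* LinearMap.GeneralLinearGroup L W) × Unit,
          (weight z.2.1 : ℚ) * 1 := by
      refine finsum_eq_of_bijective (fun z => (z.1, z.2, ())) ⟨?_, ?_⟩ (fun z => by simp)
      · rintro ⟨a, b⟩ ⟨c, d⟩ h
        simpa using h
      · rintro ⟨a, b, c⟩
        exact ⟨(a, b), rfl⟩
    rw [h2, h1, card_linearEquiv' e] at key
    have c0 : (Nat.card (LinearMap.GeneralLinearGroup K V) : ℚ) ≠ 0 := by
      exact_mod_cast Nat.card_pos.ne'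
    have c1 : (Nat.card (LinearMap.GeneralLinearGroup L W) : ℚ) ≠ 0 := by
      exact_mod_cast Nat.card_pos.ne'
    rw [eulerMass, div_eq_div_iff c0 c1, mul_comm, key]
    simp [mul_comm, finsum_unique]
  · rintro ⟨φ, Y⟩
    have hs : IsExtension pb.gen φ Y (extendHom hα φ Y) := isExtension_extendHom hα
    exact ⟨⟨_, hs.aeval_minpoly⟩, hs, fun X h => Subtype.ext (IsExtension.eq_extendHom h hα)⟩
  · rintro ⟨φ, Y⟩ X h
    exact_mod_cast IsExtension.weight_eq h
  · rintro ⟨X, hX⟩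
    obtain ⟨m, hs, hg⟩ := exists_module_of_aeval_minpoly pb hX
    have : Module.Finite L V := Module.Finite.of_finite
    have hf : Module.finrank L W = Module.finrank L V := by
      have := Module.finrank_mul_finrank K L V
      rw [hd] at this
      exact (Nat.eq_of_mul_eq_mul_left Module.finrank_pos this).symm
    exact card_isExtension pb hα hg (LinearEquiv.ofFinrankEq W V hf)

theorem eulerMass_minpoly_of_not_dvd (pb : PowerBasis K L)
    (hd : ¬ Module.finrank K L ∣ Module.finrank K V) :
    eulerMass V (intGen A) (minpoly K pb.gen) = 0 := by
  have : IsEmpty {X : A × Multiplicative ℤ →* LinearMap.GeneralLinearGroup K V //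
      Polynomial.aeval (X (intGen A) : Module.End K V) (minpoly K pb.gen) = 0} := by
    refine ⟨fun X => hd ?_⟩
    obtain ⟨m, hs, hg⟩ := exists_module_of_aeval_minpoly pb X.2
    exact ⟨_, (Module.finrank_mul_finrank K L V).symm⟩
  rw [eulerMass, finsum_of_isEmpty, zero_div]

end Irreducible

/-! ### From `ℤ_p` to `ℤ` -/

section Padic

theorem isUnit_natCast_padicInt {p : ℕ} [Fact p.Prime] {u : ℕ} (hu : ¬ p ∣ u) :
    IsUnit (u : ℤ_[p]) := by
  rw [PadicInt.isUnit_iff]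
  refine le_antisymm (PadicInt.norm_le_one _) (not_lt.mp fun h => ?_)
  have h' : ‖((u : ℤ) : ℤ_[p])‖ < 1 := by exact_mod_cast h
  rw [PadicInt.norm_int_lt_one_iff_dvd] at h'
  exact hu (by exact_mod_cast h')

theorem padicInt_exists_eq_natCast_add_mul (p : ℕ) [hp : Fact p.Prime] {N : ℕ} (hN : N ≠ 0)
    (z : ℤ_[p]) : ∃ (m : ℕ) (y : ℤ_[p]), z = m + N * y := by
  obtain ⟨k, u, hu, hk⟩ := Nat.exists_eq_pow_mul_and_not_dvd hN p hp.out.ne_one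
  obtain ⟨w, hw⟩ := Ideal.mem_span_singleton.mp (PadicInt.appr_spec k z)
  obtain ⟨v, hv⟩ := (isUnit_natCast_padicInt hu).exists_right_inv
  refine ⟨z.appr k, v * w, ?_⟩
  rw [hk]
  push_cast
  linear_combination hw - (p : ℤ_[p]) ^ k * w * hv

variable (p : ℕ) [hp : Fact p.Prime] (A : Type*) [Group A]

/-- The homomorphism `A × ℤ → A × ℤ_p`. -/
def intToPadic : A × Multiplicative ℤ →* A × Multiplicative ℤ_[p] :=
  (MonoidHom.id A).prodMap (Int.castAddHom ℤ_[p]).toMultiplicative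

variable {p A} {G : Type*} [Group G]

theorem exists_apply_intToPadic [Finite G] (X : A × Multiplicative ℤ_[p] →* G)
    (c : A × Multiplicative ℤ_[p]) : ∃ b, X c = X (intToPadic p A b) := by
  obtain ⟨a, z⟩ := c
  obtain ⟨m, y, hmy⟩ := padicInt_exists_eq_natCast_add_mul p (N := Nat.card G) Nat.card_pos.ne'
    z.toAdd
  refine ⟨(a, Multiplicative.ofAdd (m : ℤ)), ?_⟩
  have : ((a, z) : A × Multiplicative ℤ_[p]) =
      intToPadic p A (a, Multiplicative.ofAdd (m : ℤ)) *
        (1, Multiplicative.ofAdd y) ^ Nat.card G := by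
    refine Prod.ext (by simp [intToPadic]) (Multiplicative.toAdd.injective ?_)
    simp [intToPadic, hmy]
  rw [this, map_mul, map_pow, pow_card_eq_one', mul_one]

theorem apply_eq_mul_zpow (X : A × Multiplicative ℤ →* G) (a : A) (z : ℤ) :
    X (a, Multiplicative.ofAdd z) = X (a, 1) * X (intGen A) ^ z := by
  rw [eq_mul_intGen_zpow, map_mul, map_zpow]

theorem zpow_val_toZModPow {g : G} {k : ℕ} (hg : g ^ p ^ k = 1) {z : ℤ} {x : ZMod (p ^ k)}
    (h : (z : ZMod (p ^ k)) = x) : g ^ x.val = g ^ z := by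
  have : NeZero (p ^ k) := ⟨pow_ne_zero _ hp.out.ne_zero⟩
  rw [← zpow_natCast, ← h, ZMod.val_intCast]
  rw [zpow_eq_zpow_iff_modEq]
  have h1 : (orderOf g : ℤ) ∣ (p ^ k : ℕ) := by exact_mod_cast orderOf_dvd_of_pow_eq_one hg
  exact (Int.mod_modEq z _).of_dvd h1

/-- The extension of a homomorphism from `A × ℤ` to `A × ℤ_p`. -/
def padicHom (X : A × Multiplicative ℤ →* G) (k : ℕ) (h : X (intGen A) ^ p ^ k = 1) :
    A × Multiplicative ℤ_[p] →* G where
  toFun c := X (c.1, 1) * X (intGen A) ^ (PadicInt.toZModPow k c.2.toAdd).val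
  map_one' := by
    have : NeZero (p ^ k) := ⟨pow_ne_zero _ hp.out.ne_zero⟩
    change X 1 * X (intGen A) ^ (PadicInt.toZModPow k (0 : ℤ_[p])).val = 1
    rw [map_zero, map_one, ZMod.val_zero, pow_zero, one_mul]
  map_mul' c d := by
    have : NeZero (p ^ k) := ⟨pow_ne_zero _ hp.out.ne_zero⟩
    have h1 : X (intGen A) ^ (PadicInt.toZModPow k (c * d).2.toAdd).val =
        X (intGen A) ^ (PadicInt.toZModPow k c.2.toAdd).val *
          X (intGen A) ^ (PadicInt.toZModPow k d.2.toAdd).val := by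
      rw [← pow_add, ← zpow_natCast _ (_ + _)]
      refine zpow_val_toZModPow h ?_
      simp
    have h2 : X ((c * d).1, 1) = X (c.1, 1) * X (d.1, 1) := by
      rw [← map_mul]; simp
    have h3 : Commute (X (d.1, 1)) (X (intGen A)) := (commute_intGen _).map X
    rw [h1, h2]
    have := (h3.pow_right (PadicInt.toZModPow k c.2.toAdd).val).eq
    rw [mul_assoc, mul_assoc, ← mul_assoc (X (d.1, 1)), this, mul_assoc]

theorem padicHom_comp (X : A × Multiplicative ℤ →* G) (k : ℕ) (h : X (intGen A) ^ p ^ k = 1) :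
    (padicHom X k h).comp (intToPadic p A) = X := by
  refine MonoidHom.ext fun b => ?_
  obtain ⟨a, z⟩ := b
  refine Eq.trans ?_ (apply_eq_mul_zpow X a z.toAdd).symm
  change X (a, 1) * X (intGen A) ^ (PadicInt.toZModPow k ((z.toAdd : ℤ) : ℤ_[p])).val = _
  rw [zpow_val_toZModPow h (z := z.toAdd)]
  simp

theorem exists_apply_intGen_pow [Finite G] (X : A × Multiplicative ℤ_[p] →* G) :
    ∃ k : ℕ, X (intToPadic p A (intGen A)) ^ p ^ k = 1 := by
  obtain ⟨k, u, hu, hk⟩ := Nat.exists_eq_pow_mul_and_not_dvd (Nat.card_pos (α := G)).ne' p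
    hp.out.ne_one
  obtain ⟨v, hv⟩ := (isUnit_natCast_padicInt hu).exists_right_inv
  refine ⟨k, ?_⟩
  have : intToPadic p A (intGen A) ^ p ^ k = (1, Multiplicative.ofAdd v) ^ Nat.card G := by
    refine Prod.ext (by simp [intToPadic]) (Multiplicative.toAdd.injective ?_)
    simp only [intToPadic, MonoidHom.prodMap_def, MonoidHom.prod_apply, Prod.pow_snd, toAdd_pow,
      toAdd_ofAdd, MonoidHom.comp_apply, MonoidHom.coe_snd, AddMonoidHom.toMultiplicative_apply_apply,
      Int.coe_castAddHom, hk, nsmul_eq_mul, Int.cast_one, mul_one]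
    push_cast
    rw [mul_assoc, hv, mul_one]
  rw [← map_pow, this, map_pow, pow_card_eq_one']

end Padic

section Sum

variable {K V : Type*} [Field K] [AddCommGroup V] [Module K V]

theorem weight_comp {B C : Type*} [Group B] [Group C] (X : C →* LinearMap.GeneralLinearGroup K V)
    (f : B →* C) (h : ∀ c, ∃ b, X c = X (f b)) : weight (X.comp f) = weight X := by
  have : invSub (X.comp f) = invSub X := by
    refine SetLike.ext fun U => ?_
    refine ⟨fun hU c v hv => ?_, fun hU b v hv => hU (f b) v hv⟩
    obtain ⟨b, hb⟩ := h c
    rw [hb]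
    exact hU b v hv
  unfold weight
  refine moebius_congr
    { toFun := fun U => ⟨U.1, this.le U.2⟩
      invFun := fun U => ⟨U.1, this.ge U.2⟩
      left_inv := fun _ => rfl
      right_inv := fun _ => rfl
      map_rel_iff' := Iff.rfl }

/-- The normalized sum of the weights of the representations of `A` on `V`. -/
def homMass (A K V : Type*) [Group A] [Field K] [AddCommGroup V] [Module K V] : ℚ :=
  (∑ᶠ Y : A →* LinearMap.GeneralLinearGroup K V, (weight Y : ℚ)) /
    Nat.card (LinearMap.GeneralLinearGroup K V)

theorem homMass_of_subsingleton (A : Type*) [Group A] [Subsingleton V] : homMass A K V = 1 := by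
  have h1 : Unique (LinearMap.GeneralLinearGroup K V) := ⟨⟨1⟩, unit_eq_one_of_subsingleton⟩
  have h2 : Unique (A →* LinearMap.GeneralLinearGroup K V) :=
    ⟨⟨1⟩, fun X => MonoidHom.ext fun b =>
      (unit_eq_one_of_subsingleton _).trans (unit_eq_one_of_subsingleton _).symm⟩
  rw [homMass, finsum_unique, weight_of_subsingleton, Nat.card_unique]
  simp

theorem homMass_congr {A A' : Type*} [Group A] [Group A'] (e : A ≃* A') :
    homMass A K V = homMass A' K V := by
  rw [homMass, homMass]
  congr 1
  refine finsum_eq_of_bijective (fun X => X.comp e.symm.toMonoidHom) ⟨?_, ?_⟩ ?_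
  · intro X Y h
    refine MonoidHom.ext fun a => ?_
    have := DFunLike.congr_fun h (e a)
    simpa using this
  · intro X
    exact ⟨X.comp e.toMonoidHom, MonoidHom.ext fun a => by simp⟩
  · intro X
    rw [weight_comp]
    exact fun c => ⟨e c, by simp⟩

theorem homMass_prod_padicInt [Finite V] {p : ℕ} [Fact p.Prime] {A : Type*} [Group A] {k : ℕ}
    (hk : ∀ X : A × Multiplicative ℤ →* LinearMap.GeneralLinearGroup K V, weight X ≠ 0 →
      (∃ j : ℕ, X (intGen A) ^ p ^ j = 1) → X (intGen A) ^ p ^ k = 1) :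
    homMass (A × Multiplicative ℤ_[p]) K V =
      eulerMass V (intGen A) (Polynomial.X ^ p ^ k - 1 : K[X]) := by
  have hiff : ∀ X : A × Multiplicative ℤ →* LinearMap.GeneralLinearGroup K V,
      Polynomial.aeval (X (intGen A) : Module.End K V) (Polynomial.X ^ p ^ k - 1 : K[X]) = 0 ↔
        X (intGen A) ^ p ^ k = 1 := by
    intro X
    rw [map_sub, map_pow, Polynomial.aeval_X, map_one, sub_eq_zero, ← Units.val_pow_eq_pow_val,
      Units.val_eq_one]
  rw [homMass, eulerMass]
  congr 1
  have h1 : ∑ᶠ X : A × Multiplicative ℤ_[p] →* LinearMap.GeneralLinearGroup K V, (weight X : ℚ) =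
      ∑ᶠ X : {X : A × Multiplicative ℤ →* LinearMap.GeneralLinearGroup K V //
        ∃ j : ℕ, X (intGen A) ^ p ^ j = 1}, (weight X.1 : ℚ) := by
    refine finsum_eq_of_bijective
      (fun X => ⟨X.comp (intToPadic p A), exists_apply_intGen_pow X⟩) ⟨?_, ?_⟩ ?_
    · intro X Y h
      have h' := congrArg Subtype.val h
      refine MonoidHom.ext fun c => ?_
      obtain ⟨b, hb⟩ := exists_apply_intToPadic (X.prod Y) c
      have hb1 := congrArg Prod.fst hb
      have hb2 := congrArg Prod.snd hb
      simp only [MonoidHom.prod_apply] at hb1 hb2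
      rw [hb1, hb2]
      exact DFunLike.congr_fun h' b
    · rintro ⟨X, j, hj⟩
      exact ⟨padicHom X j hj, Subtype.ext (padicHom_comp X j hj)⟩
    · intro X
      rw [weight_comp _ _ (exists_apply_intToPadic X)]
  rw [h1]
  refine (finsum_subtype_eq_finsum_cond (f := fun X : A × Multiplicative ℤ →*
    LinearMap.GeneralLinearGroup K V => (weight X : ℚ)) _).trans (Eq.trans ?_
      (finsum_subtype_eq_finsum_cond (f := fun X : A × Multiplicative ℤ →*
        LinearMap.GeneralLinearGroup K V => (weight X : ℚ)) _).symm)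
  classical
  refine finsum_congr fun X => ?_
  by_cases hX : X (intGen A) ^ p ^ k = 1
  · rw [finsum_eq_if, finsum_eq_if, if_pos ⟨k, hX⟩, if_pos ((hiff X).2 hX)]
  · rw [finsum_eq_if, finsum_eq_if, if_neg (fun h => hX ((hiff X).1 h))]
    split_ifs with h
    · by_contra h0
      exact hX (hk X (by exact_mod_cast h0) h)
    · rfl

/-- A central unipotent element acting nontrivially makes the weight vanish. -/
theorem weight_eq_zero [Finite V] {B : Type*} [Group B] (p : ℕ) [Fact p.Prime] [CharP K p]
    (X : B →* LinearMap.GeneralLinearGroup K V) {t : B} (ht : ∀ b, Commute b t) {j : ℕ}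
    (hj : X t ^ p ^ j = 1) (h1 : X t ≠ 1) : weight X = 0 := by
  set N : Module.End K V := (X t : Module.End K V) - 1 with hN
  have hnil : N ^ p ^ j = 0 := by
    have h2 : N = Polynomial.aeval (X t : Module.End K V) (Polynomial.X - 1 : K[X]) := by
      simp [hN]
    rw [h2, ← map_pow, sub_pow_char_pow, one_pow, map_sub, map_pow, Polynomial.aeval_X, map_one,
      ← Units.val_pow_eq_pow_val, hj, Units.val_one, sub_self]
  have hmem : ∀ (U : invSub X) {v : V}, v ∈ U.1 → N v ∈ U.1 := fun U v hv =>
    U.1.sub_mem (U.2 t v hv) hv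
  have hR : LinearMap.range N ∈ invSub X := by
    rintro b _ ⟨v, rfl⟩
    refine ⟨(X b : V →ₗ[K] V) v, ?_⟩
    have := congrArg (fun g : LinearMap.GeneralLinearGroup K V => (g : V →ₗ[K] V) v)
      ((ht b).map X).eq
    have h3 : (X b : V →ₗ[K] V) ((X t : V →ₗ[K] V) v) =
      (X t : V →ₗ[K] V) ((X b : V →ₗ[K] V) v) := this
    rw [hN]
    simp only [LinearMap.sub_apply, Module.End.one_apply, map_sub, h3]
  refine moebius_eq_zero (⟨LinearMap.range N, hR⟩ : invSub X) ?_ ?_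
  · intro h
    have h2 : N = 0 := LinearMap.range_eq_bot.1 (congrArg Subtype.val h)
    exact h1 (Units.ext (sub_eq_zero.1 h2))
  · intro U hU
    have hU' : U.1 ⊔ LinearMap.range N = ⊤ := congrArg Subtype.val hU
    have key : ∀ (m : ℕ) (v : V), ∃ u ∈ U.1, ∃ w, v = u + (N ^ m) w := by
      intro m
      induction m with
      | zero => exact fun v => ⟨0, U.1.zero_mem, v, by simp⟩
      | succ m ih =>
        intro v
        obtain ⟨u, hu, _, ⟨w, rfl⟩, rfl⟩ :=
          Submodule.mem_sup.1 (hU' ▸ Submodule.mem_top : v ∈ U.1 ⊔ LinearMap.range N)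
        obtain ⟨u', hu', w', rfl⟩ := ih w
        refine ⟨u + N u', U.1.add_mem hu (hmem U hu'), w', ?_⟩
        rw [map_add, pow_succ', Module.End.mul_apply, add_assoc]
    refine Subtype.ext (eq_top_iff.2 fun v _ => ?_)
    obtain ⟨u, hu, w, hv⟩ := key (p ^ j) v
    rw [hv, hnil]
    simpa using hu

end Sum

/-! ### Power series congruences -/

section Congruence

variable {R : Type*} [CommRing R]

theorem X_pow_dvd_prod_sub_one {ι : Type*} (s : Finset ι) (F : ι → R⟦X⟧) {N : ℕ}
    (h : ∀ i ∈ s, PowerSeries.X ^ N ∣ F i - 1) : PowerSeries.X ^ N ∣ ∏ i ∈ s, F i - 1 := by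
  classical
  induction s using Finset.induction_on with
  | empty => simp
  | insert a s ha ih =>
    rw [Finset.prod_insert ha]
    have h1 := ih fun i hi => h i (Finset.mem_insert_of_mem hi)
    have h2 := h a (Finset.mem_insert_self _ _)
    have : F a * ∏ i ∈ s, F i - 1 = F a * (∏ i ∈ s, F i - 1) + (F a - 1) := by ring
    rw [this]
    exact dvd_add (dvd_mul_of_dvd_right h1 _) h2

theorem coeff_eq_of_X_pow_dvd {n : ℕ} {F G : R⟦X⟧} (h : PowerSeries.X ^ (n + 1) ∣ F - G) :
    PowerSeries.coeff n F = PowerSeries.coeff n G := by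
  have := PowerSeries.X_pow_dvd_iff.1 h n (Nat.lt_succ_self n)
  rwa [map_sub, sub_eq_zero] at this

theorem coeff_prod_of_subset {ι : Type*} {s t : Finset ι} (hst : s ⊆ t) (F : ι → R⟦X⟧) {n : ℕ}
    (h : ∀ i ∈ t, i ∉ s → PowerSeries.X ^ (n + 1) ∣ F i - 1) :
    PowerSeries.coeff n (∏ i ∈ t, F i) = PowerSeries.coeff n (∏ i ∈ s, F i) := by
  classical
  rw [← Finset.prod_sdiff hst]
  refine coeff_eq_of_X_pow_dvd ?_
  have h1 := X_pow_dvd_prod_sub_one (t \ s) F (N := n + 1) fun i hi =>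
    h i (Finset.mem_sdiff.1 hi).1 (Finset.mem_sdiff.1 hi).2
  have : (∏ i ∈ t \ s, F i) * ∏ i ∈ s, F i - ∏ i ∈ s, F i =
    (∏ i ∈ t \ s, F i - 1) * ∏ i ∈ s, F i := by ring
  rw [this]
  exact dvd_mul_of_dvd_left h1 _

theorem X_pow_dvd_expand_sub_one {d n : ℕ} (hd : d ≠ 0) (hn : n < d) {F : R⟦X⟧}
    (hF : PowerSeries.coeff 0 F = 1) :
    PowerSeries.X ^ (n + 1) ∣ PowerSeries.expand d hd F - 1 := by
  rw [PowerSeries.X_pow_dvd_iff]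
  intro m hm
  rw [map_sub, PowerSeries.coeff_expand, PowerSeries.coeff_one]
  rcases eq_or_ne m 0 with rfl | hm0
  · simpa [sub_eq_zero] using hF
  · rw [if_neg hm0, if_neg, sub_zero]
    exact Nat.not_dvd_of_pos_of_lt (Nat.pos_of_ne_zero hm0) (by omega)

theorem X_pow_dvd_pow_sub_one {F : R⟦X⟧} {N : ℕ} (h : PowerSeries.X ^ N ∣ F - 1) (m : ℕ) :
    PowerSeries.X ^ N ∣ F ^ m - 1 :=
  h.trans (sub_one_dvd_pow_sub_one F m)

end Congruence

/-! ### Comparison with the generating functions -/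

section GenFun

variable (p : ℕ) [hp : Fact p.Prime]

instance finite_source_hom (r : ℕ) (G : Type*) [Group G] [Finite G] : Finite (Source p r →* G) :=
  finite_hom p r G

instance finite_prod_int_hom (A G : Type*) [Group A] [Group G] [Finite G] [Finite (A →* G)] :
    Finite (A × Multiplicative ℤ →* G) := by
  refine Finite.of_injective (fun X : A × Multiplicative ℤ →* G =>
    (X.comp (MonoidHom.inl _ _), X (intGen A))) fun X Y h => MonoidHom.ext fun b => ?_
  obtain ⟨a, z⟩ := b
  have h1 : X (a, 1) = Y (a, 1) := DFunLike.congr_fun (congrArg Prod.fst h) a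
  have h2 : X (intGen A) = Y (intGen A) := congrArg Prod.snd h
  have hX := apply_eq_mul_zpow X a z.toAdd
  have hY := apply_eq_mul_zpow Y a z.toAdd
  rw [h1, h2, ← hY] at hX
  exact hX

variable {p}

theorem coeff_genFun {q : ℕ} (hq : IsPrimePow q) (r n : ℕ) :
    PowerSeries.coeff n (genFun p r q) =
      homMass (Source p r) (FF q hq) (Fin n → FF q hq) := by
  rw [genFun, PowerSeries.coeff_mk]
  rcases eq_or_ne n 0 with rfl | hn
  · rw [if_pos rfl, homMass_of_subsingleton]
  · have : NeZero n := ⟨hn⟩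
    rw [if_neg hn, chi, dif_pos hq, equivariantEuler, homMass]
    simp only [weight_of_nontrivial]

theorem coeff_zero_genFun (r q : ℕ) : PowerSeries.coeff 0 (genFun p r q) = 1 := by
  rw [genFun, PowerSeries.coeff_mk, if_pos rfl]

theorem card_adjoinRoot {K : Type*} [Field K] [Finite K] {f : K[X]} (hf : f ≠ 0) :
    Nat.card (AdjoinRoot f) = Nat.card K ^ f.natDegree := by
  have := (AdjoinRoot.powerBasis hf).finite
  rw [Module.natCard_eq_pow_finrank (K := K), (AdjoinRoot.powerBasis hf).finrank,
    AdjoinRoot.powerBasis_dim]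

theorem exists_powerBasis {K L : Type*} [Field K] [Field L] [Finite K] [Finite L] {f : K[X]}
    (hf : Irreducible f) (hm : f.Monic) (hc : Nat.card L = Nat.card K ^ f.natDegree) :
    ∃ (_ : Algebra K L) (pb : PowerBasis K L), minpoly K pb.gen = f := by
  have : Fact (Irreducible f) := ⟨hf⟩
  have : Finite (AdjoinRoot f) := Nat.finite_of_card_ne_zero (by
    rw [card_adjoinRoot hf.ne_zero]
    exact pow_ne_zero _ Nat.card_pos.ne')
  have := Fintype.ofFinite (AdjoinRoot f)
  have := Fintype.ofFinite L
  let e : AdjoinRoot f ≃+* L := FiniteField.ringEquivOfCardEq (by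
    rw [← Nat.card_eq_fintype_card, ← Nat.card_eq_fintype_card, hc, card_adjoinRoot hf.ne_zero])
  let alg : Algebra K L := ((e : AdjoinRoot f →+* L).comp (AdjoinRoot.of f)).toAlgebra
  let e' : AdjoinRoot f ≃ₐ[K] L := AlgEquiv.ofRingEquiv (f := e) fun x => rfl
  refine ⟨alg, (AdjoinRoot.powerBasis hf.ne_zero).map e', ?_⟩
  rw [PowerBasis.map_gen, minpoly.algEquiv_eq, AdjoinRoot.powerBasis_gen,
    AdjoinRoot.minpoly_root hf.ne_zero, hm.leadingCoeff]
  simp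

theorem massSeries_irreducible {q : ℕ} (hq : IsPrimePow q) (r : ℕ) {f : (FF q hq)[X]}
    (hf : Irreducible f) (hm : f.Monic) (h0 : f.coeff 0 ≠ 0) (d : ℕ+) (hd : f.natDegree = d) :
    massSeries (intGen (Source p r)) f =
      PowerSeries.expand (d : ℕ) d.ne_zero (genFun p r (q ^ (d : ℕ))) := by
  have hqd : IsPrimePow (q ^ (d : ℕ)) := hq.pow d.ne_zero
  obtain ⟨alg, pb, hpb⟩ := exists_powerBasis (L := FF _ hqd) hf hm
    (by rw [card_FF, card_FF, hd])
  have hgen : pb.gen ≠ 0 := by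
    intro h
    have h1 := minpoly.aeval (FF q hq) pb.gen
    rw [hpb, h, Polynomial.aeval_def, Polynomial.eval₂_at_zero,
      map_eq_zero_iff _ (algebraMap (FF q hq) (FF _ hqd)).injective] at h1
    exact h0 h1
  have hdeg : Module.finrank (FF q hq) (FF _ hqd) = d := by
    rw [pb.finrank, ← pb.natDegree_minpoly, hpb, hd]
  ext n
  rw [massSeries, PowerSeries.coeff_mk, PowerSeries.coeff_expand]
  split_ifs with hdn
  · obtain ⟨m, rfl⟩ := hdn
    rw [Nat.mul_div_cancel_left _ d.pos, coeff_genFun hqd]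
    conv_lhs => rw [← hpb]
    exact eulerMass_minpoly (W := Fin m → FF _ hqd) pb hgen (by
      rw [Module.finrank_fin_fun, Module.finrank_fin_fun, hdeg])
  · conv_lhs => rw [← hpb]
    exact eulerMass_minpoly_of_not_dvd pb (by rwa [Module.finrank_fin_fun, hdeg])

variable (p) in
/-- Splitting off a factor `ℤ_p`. -/
def sourceSuccEquiv (s : ℕ) :
    Source p (s + 2) ≃* Source p (s + 1) × Multiplicative ℤ_[p] where
  toFun c := (Multiplicative.ofAdd (c.toAdd.1, fun i : Fin s => c.toAdd.2 (Fin.succ (n := s) i)),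
    Multiplicative.ofAdd (c.toAdd.2 (0 : Fin (s + 1))))
  invFun c := Multiplicative.ofAdd
    (c.1.toAdd.1, (Fin.cons c.2.toAdd c.1.toAdd.2 : Fin (s + 1) → ℤ_[p]))
  left_inv c := by
    refine Multiplicative.toAdd.injective (Prod.ext rfl (funext fun i : Fin (s + 1) => ?_))
    refine Fin.cases rfl (fun i => rfl) i
  right_inv c := rfl
  map_mul' c d := rfl

theorem homMass_source_succ {K V : Type*} [Field K] [AddCommGroup V] [Module K V] {r : ℕ}
    (hr : 1 ≤ r) :
    homMass (Source p (r + 1)) K V = homMass (Source p r × Multiplicative ℤ_[p]) K V := by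
  obtain ⟨s, rfl⟩ := Nat.exists_eq_add_of_le' hr
  exact homMass_congr (sourceSuccEquiv p s)

theorem polyOrder_eq_orderOf {K : Type*} [Field K] (f : K[X]) :
    polyOrder f = orderOf (AdjoinRoot.root f) := by
  have hiff : ∀ e : ℕ, f ∣ Polynomial.X ^ e - 1 ↔ AdjoinRoot.root f ^ e = 1 := by
    intro e
    rw [← AdjoinRoot.mk_eq_zero, map_sub, map_pow, AdjoinRoot.mk_X, map_one, sub_eq_zero]
  simp only [polyOrder, hiff]
  by_cases h : IsOfFinOrder (AdjoinRoot.root f)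
  · refine le_antisymm (Nat.sInf_le ⟨h.orderOf_pos, pow_orderOf_eq_one _⟩) ?_
    have hne : {e : ℕ | 0 < e ∧ AdjoinRoot.root f ^ e = 1}.Nonempty :=
      ⟨_, h.orderOf_pos, pow_orderOf_eq_one _⟩
    exact orderOf_le_of_pow_eq_one (Nat.sInf_mem hne).1 (Nat.sInf_mem hne).2
  · rw [orderOf_eq_zero h]
    refine Nat.sInf_eq_zero.2 (Or.inr (Set.eq_empty_of_forall_notMem ?_))
    rintro e ⟨he, h1⟩
    exact h (isOfFinOrder_iff_pow_eq_one.2 ⟨e, he, h1⟩)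

theorem dvd_X_pow_sub_one_iff {K : Type*} [Field K] (f : K[X]) (e : ℕ) :
    f ∣ Polynomial.X ^ e - 1 ↔ polyOrder f ∣ e := by
  rw [polyOrder_eq_orderOf, orderOf_dvd_iff_pow_eq_one, ← AdjoinRoot.mk_eq_zero, map_sub, map_pow,
    AdjoinRoot.mk_X, map_one, sub_eq_zero]

theorem finite_natDegree_le (K : Type*) [Field K] [Finite K] (n : ℕ) :
    Finite {f : K[X] // f.natDegree ≤ n} := by
  refine Finite.of_injective (fun f (i : Fin (n + 1)) => f.1.coeff i) fun f g h => ?_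
  refine Subtype.ext (Polynomial.ext fun i => ?_)
  by_cases hi : i ≤ n
  · exact congrFun h ⟨i, by omega⟩
  · rw [Polynomial.coeff_eq_zero_of_natDegree_lt (f.2.trans_lt (not_le.1 hi)),
      Polynomial.coeff_eq_zero_of_natDegree_lt (g.2.trans_lt (not_le.1 hi))]

variable (p) in
theorem exists_exponent (A K : Type*) [Group A] [Field K] [Finite K] (n : ℕ) :
    ∃ k : ℕ, ((p ^ k : ℕ) : K) ≠ 0 ∧
      (∀ X : A × Multiplicative ℤ →* LinearMap.GeneralLinearGroup K (Fin n → K), weight X ≠ 0 →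
        (∃ j : ℕ, X (intGen A) ^ p ^ j = 1) → X (intGen A) ^ p ^ k = 1) ∧
      ∀ f : K[X], Irreducible f → f.natDegree ≤ n → (∃ j : ℕ, polyOrder f = p ^ j) →
        f ∣ Polynomial.X ^ p ^ k - 1 := by
  by_cases hpK : (p : K) = 0
  · have : CharP K p := by
      obtain ⟨c, hc⟩ := CharP.exists K
      have h1 := (CharP.cast_eq_zero_iff K c p).1 hpK
      rcases (Nat.dvd_prime hp.out).1 h1 with rfl | rfl
      · exact absurd rfl (CharP.char_ne_one K 1)
      · exact hc
    refine ⟨0, by simp, fun X hX => ?_, fun f hf _ => ?_⟩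
    · rintro ⟨j, hj⟩
      rw [pow_zero, pow_one]
      by_contra h1
      exact hX (weight_eq_zero p X commute_intGen hj h1)
    · rintro ⟨j, hj⟩
      have h1 := (dvd_X_pow_sub_one_iff f (p ^ j)).2 hj.dvd
      have h2 : (Polynomial.X ^ p ^ j - 1 : K[X]) = (Polynomial.X - 1) ^ p ^ j := by
        rw [sub_pow_char_pow, one_pow]
      rw [h2] at h1
      rw [pow_zero, pow_one]
      exact hf.prime.dvd_of_dvd_pow h1
  · have := finite_natDegree_le K n
    have e1 : ∀ᶠ k : ℕ in Filter.atTop, ∀ g : LinearMap.GeneralLinearGroup K (Fin n → K),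
        (∃ j : ℕ, g ^ p ^ j = 1) → g ^ p ^ k = 1 := by
      rw [Filter.eventually_all]
      intro g
      by_cases h : ∃ j : ℕ, g ^ p ^ j = 1
      · obtain ⟨j, hj⟩ := h
        filter_upwards [Filter.eventually_ge_atTop j] with k hk _
        obtain ⟨i, rfl⟩ := Nat.exists_eq_add_of_le hk
        rw [pow_add, pow_mul, hj, one_pow]
      · exact Filter.Eventually.of_forall fun k h' => absurd h' h
    have e2 : ∀ᶠ k : ℕ in Filter.atTop, ∀ f : {f : K[X] // f.natDegree ≤ n},
        (∃ j : ℕ, polyOrder f.1 = p ^ j) → f.1 ∣ Polynomial.X ^ p ^ k - 1 := by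
      rw [Filter.eventually_all]
      intro f
      by_cases h : ∃ j : ℕ, polyOrder f.1 = p ^ j
      · obtain ⟨j, hj⟩ := h
        filter_upwards [Filter.eventually_ge_atTop j] with k hk _
        rw [dvd_X_pow_sub_one_iff, hj]
        exact pow_dvd_pow p hk
      · exact Filter.Eventually.of_forall fun k h' => absurd h' h
    obtain ⟨k, h1, h2⟩ := (e1.and e2).exists
    refine ⟨k, by simpa using fun h => absurd h hpK, fun X _ => h1 _, fun f _ hf => h2 ⟨f, hf⟩⟩

/-- The positive integers up to `n`. -/
def pnatUpTo (n : ℕ) : Finset ℕ+ :=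
  (Finset.range n).map ⟨Nat.succPNat, Nat.succPNat_injective⟩

theorem mem_pnatUpTo {n : ℕ} {d : ℕ+} : d ∈ pnatUpTo n ↔ (d : ℕ) ≤ n := by
  simp only [pnatUpTo, Finset.mem_map, Finset.mem_range, Function.Embedding.coeFn_mk]
  constructor
  · rintro ⟨i, hi, rfl⟩
    exact hi
  · intro h
    exact ⟨d.natPred, by have := d.natPred_add_one; omega, d.succPNat_natPred⟩

theorem coeff_genFun_succ {q : ℕ} (hq : IsPrimePow q) {r : ℕ} (hr : 1 ≤ r) (n : ℕ) :
    PowerSeries.coeff n (genFun p (r + 1) q) = PowerSeries.coeff n (∏ d ∈ pnatUpTo n,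
      (PowerSeries.expand (d : ℕ) d.ne_zero (genFun p r (q ^ (d : ℕ)))) ^ irrCount p d q) := by
  classical
  obtain ⟨k, hk0, hk1, hk2⟩ := exists_exponent p (Source p r) (FF q hq) n
  set h : (FF q hq)[X] := Polynomial.X ^ p ^ k - 1 with hh
  have hpk : p ^ k ≠ 0 := pow_ne_zero _ hp.out.ne_zero
  have hmonic : h.Monic := Polynomial.monic_X_pow_sub_C 1 hpk
  have hne : h ≠ 0 := hmonic.ne_zero
  have hsq : Squarefree h := (Polynomial.X_pow_sub_one_separable_iff.2 hk0).squarefree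
  set S : Finset (FF q hq)[X] := (UniqueFactorizationMonoid.normalizedFactors h).toFinset with hS
  have hmem : ∀ f, f ∈ S ↔ Irreducible f ∧ f.Monic ∧ f ∣ h := fun f => by
    rw [hS, Multiset.mem_toFinset, Polynomial.mem_normalizedFactors_iff hne]
  have hprod : ∏ f ∈ S, f = h := by
    have h1 := UniqueFactorizationMonoid.prod_normalizedFactors_eq hne
    rw [hmonic.normalize_eq_self] at h1
    rw [Finset.prod, Multiset.map_id', hS, Multiset.toFinset_val, Multiset.dedup_eq_self.2
      ((UniqueFactorizationMonoid.squarefree_iff_nodup_normalizedFactors hne).1 hsq), h1]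
  have hcop : (S : Set (FF q hq)[X]).Pairwise IsCoprime := by
    intro f hf g hg hfg
    have hf' := (hmem f).1 hf
    have hg' := (hmem g).1 hg
    refine (hf'.1.coprime_iff_not_dvd).2 fun hdvd => hfg ?_
    exact Polynomial.eq_of_monic_of_associated hf'.2.1 hg'.2.1
      (hf'.1.associated_of_dvd hg'.1 hdvd)
  have h0 : ∀ f ∈ S, f.coeff 0 ≠ 0 := by
    intro f hf hf0
    have h1 : h.coeff 0 = 0 := by
      obtain ⟨g, hg⟩ := ((hmem f).1 hf).2.2
      rw [hg, Polynomial.mul_coeff_zero, hf0, zero_mul]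
    rw [hh] at h1
    simp [Polynomial.coeff_X_pow, hpk.symm] at h1
  have hdeg : ∀ f ∈ S, ((f.natDegree.toPNat' : ℕ+) : ℕ) = f.natDegree := fun f hf => by
    rw [Nat.toPNat'_coe, if_pos ((hmem f).1 hf).1.natDegree_pos]
  rw [coeff_genFun hq, homMass_source_succ hr, homMass_prod_padicInt hk1]
  have h1 : eulerMass (Fin n → FF q hq) (intGen (Source p r)) h =
      PowerSeries.coeff n (massSeries (intGen (Source p r)) h) := by
    rw [massSeries, PowerSeries.coeff_mk]
  rw [h1, ← hprod, massSeries_prod commute_intGen S hcop]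
  rw [Finset.prod_congr rfl fun f hf => massSeries_irreducible hq r ((hmem f).1 hf).1
    ((hmem f).1 hf).2.1 (h0 f hf) f.natDegree.toPNat' (hdeg f hf).symm]
  set E : ℕ+ → ℚ⟦X⟧ := fun d =>
    PowerSeries.expand (d : ℕ) d.ne_zero (genFun p r (q ^ (d : ℕ))) with hE
  change PowerSeries.coeff n (∏ f ∈ S, E f.natDegree.toPNat') =
    PowerSeries.coeff n (∏ d ∈ pnatUpTo n, E d ^ irrCount p d q)
  rw [coeff_prod_of_subset (Finset.filter_subset (fun f => f.natDegree ≤ n) S)]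
  · rw [← Finset.prod_fiberwise_of_maps_to (t := pnatUpTo n)
      (g := fun f : (FF q hq)[X] => f.natDegree.toPNat')]
    · congr 1
      refine Finset.prod_congr rfl fun d hd => ?_
      rw [Finset.prod_congr rfl (g := fun _ => E d) fun f hf => by
        rw [(Finset.mem_filter.1 hf).2], Finset.prod_const]
      congr 1
      rw [irrCount, dif_pos hq, ← Set.ncard_coe_finset]
      congr 1
      ext f
      simp only [Finset.coe_filter, Finset.mem_filter, Set.mem_ofPred_eq]
      constructor
      · rintro ⟨⟨hf, hfn⟩, hfd⟩
        have hf' := (hmem f).1 hf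
        refine ⟨hf'.2.1, hf'.1, by rw [← hfd, hdeg f hf], h0 f hf, ?_⟩
        have h2 := (dvd_X_pow_sub_one_iff f (p ^ k)).1 hf'.2.2
        obtain ⟨j, -, hj⟩ := (Nat.dvd_prime_pow hp.out).1 h2
        exact ⟨j, hj⟩
      · rintro ⟨hfm, hfi, hfd, hf0, hfo⟩
        have hle : f.natDegree ≤ n := hfd ▸ mem_pnatUpTo.1 hd
        refine ⟨⟨(hmem f).2 ⟨hfi, hfm, hk2 f hfi hle hfo⟩, hle⟩, ?_⟩
        rw [hfd]
        exact PNat.coe_toPNat' d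
    · intro f hf
      rw [mem_pnatUpTo, hdeg f (Finset.mem_filter.1 hf).1]
      exact (Finset.mem_filter.1 hf).2
  · intro f hf hfn
    refine X_pow_dvd_expand_sub_one _ ?_ (coeff_zero_genFun _ _)
    rw [hdeg f hf]
    by_contra hlt
    exact hfn (Finset.mem_filter.2 ⟨hf, not_lt.1 hlt⟩)

theorem hasFormalProd_genFun {q : ℕ} (hq : IsPrimePow q) {r : ℕ} (hr : 1 ≤ r) :
    HasFormalProd (fun d : ℕ+ =>
      (PowerSeries.expand (d : ℕ) d.ne_zero (genFun p r (q ^ (d : ℕ)))) ^ irrCount p d q)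
      (genFun p (r + 1) q) := by
  intro n
  filter_upwards [Filter.eventually_ge_atTop (pnatUpTo n)] with s hs
  rw [coeff_genFun_succ hq hr]
  refine coeff_prod_of_subset hs _ fun d _ hd => X_pow_dvd_pow_sub_one ?_ _
  refine X_pow_dvd_expand_sub_one _ ?_ (coeff_zero_genFun _ _)
  by_contra hlt
  exact hd (mem_pnatUpTo.2 (not_lt.1 hlt))

end GenFun

/-! ### The transform of a power series as a product -/

section Transform

theorem multinom_natCast {ι : Type*} (N : ℕ) (s : Finset ι) (k : ι → ℕ) :
    multinom (N : ℤ) s k = (N.descFactorial (∑ i ∈ s, k i) : ℚ) / ∏ i ∈ s, ((k i).factorial : ℚ) := by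
  rw [multinom]
  congr 1
  generalize ∑ i ∈ s, k i = j
  induction j with
  | zero => simp
  | succ j ih =>
    rw [Finset.prod_range_succ, ih, Nat.descFactorial_succ]
    rcases le_or_gt j N with h | h
    · push_cast [Nat.cast_sub h]
      ring
    · rw [Nat.descFactorial_of_lt h]
      simp

theorem multinom_eq_zero {ι : Type*} {N : ℕ} {s : Finset ι} {k : ι → ℕ} (h : N < ∑ i ∈ s, k i) :
    multinom (N : ℤ) s k = 0 := by
  rw [multinom_natCast, Nat.descFactorial_of_lt h, Nat.cast_zero, zero_div]

theorem multinom_eq_choose_mul {ι : Type*} (N : ℕ) (s : Finset ι) (k : ι → ℕ) :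
    multinom (N : ℤ) s k = N.choose (∑ i ∈ s, k i) * Nat.multinomial s k := by
  have h1 := Nat.multinomial_spec s k
  have h2 : ((∏ i ∈ s, (k i).factorial : ℕ) : ℚ) ≠ 0 :=
    Nat.cast_ne_zero.2 (Finset.prod_ne_zero_iff.2 fun i _ => Nat.factorial_ne_zero _)
  rw [multinom_natCast, ← Nat.cast_prod, div_eq_iff h2, Nat.descFactorial_eq_factorial_mul_choose,
    ← h1]
  push_cast
  ring

theorem one_add_sum_pow {ι : Type*} [Fintype ι] [DecidableEq ι] {N B : ℕ} (hB : N ≤ B)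
    (a : ι → ℚ) (w : ι → ℕ) :
    (1 + ∑ i, PowerSeries.C (a i) * PowerSeries.X ^ w i : ℚ⟦X⟧) ^ N =
      ∑ k ∈ Fintype.piFinset fun _ : ι => Finset.range (B + 1),
        PowerSeries.C (multinom (N : ℤ) Finset.univ k * ∏ i, a i ^ k i) *
          PowerSeries.X ^ ∑ i, k i * w i := by
  set y : ι → ℚ⟦X⟧ := fun i => PowerSeries.C (a i) * PowerSeries.X ^ w i with hy
  have hterm : ∀ k : ι → ℕ, PowerSeries.C (multinom (N : ℤ) Finset.univ k * ∏ i, a i ^ k i) *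
      PowerSeries.X ^ ∑ i, k i * w i =
      (N.choose (∑ i, k i) : ℚ⟦X⟧) * ((Nat.multinomial Finset.univ k : ℚ⟦X⟧) * ∏ i, y i ^ k i) := by
    intro k
    have h1 : ∏ i, y i ^ k i = PowerSeries.C (∏ i, a i ^ k i) *
        PowerSeries.X ^ ∑ i, k i * w i := by
      simp only [hy, mul_pow, Finset.prod_mul_distrib, map_prod, map_pow, ← pow_mul,
        Finset.prod_pow_eq_pow_sum, mul_comm (w _)]
    rw [h1, multinom_eq_choose_mul, map_mul, map_mul, map_natCast, map_natCast]
    ring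
  have hsub : ((Fintype.piFinset fun _ : ι => Finset.range (B + 1)).filter
      fun k : ι → ℕ => ∑ i, k i ∈ Finset.range (B + 1)) ⊆
      Fintype.piFinset fun _ : ι => Finset.range (B + 1) := Finset.filter_subset _ _
  rw [← Finset.sum_subset hsub, ← Finset.sum_fiberwise_of_maps_to (t := Finset.range (B + 1))
    (g := fun k : ι → ℕ => ∑ i, k i)]
  · rw [add_comm, add_pow]
    simp only [one_pow, mul_one]
    have h2 : Finset.range (N + 1) ⊆ Finset.range (B + 1) :=
      Finset.range_subset_range.2 (by omega)
    rw [Finset.sum_subset h2]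
    · refine Finset.sum_congr rfl fun j hj => ?_
      rw [Finset.sum_pow_eq_sum_piAntidiag, Finset.sum_mul]
      refine Finset.sum_congr ?_ fun k hk => ?_
      · ext k
        simp only [Finset.mem_piAntidiag, Finset.mem_filter, Fintype.mem_piFinset,
          Finset.mem_range] at hj ⊢
        constructor
        · rintro ⟨(hk : ∑ i, k i = j), -⟩
          refine ⟨⟨fun i => ?_, by omega⟩, hk⟩
          have := Finset.single_le_sum (f := k) (fun i _ => Nat.zero_le _) (Finset.mem_univ i)
          omega
        · rintro ⟨-, hk⟩
          exact ⟨hk, fun i _ => Finset.mem_univ i⟩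
      · have hkj : ∑ i, k i = j := (Finset.mem_filter.1 hk).2
        rw [hterm, hkj, mul_comm]
    · intro j _ hj
      rw [Nat.choose_eq_zero_of_lt (by simpa using hj), Nat.cast_zero, mul_zero]
  · exact fun k hk => (Finset.mem_filter.1 hk).2
  · intro k hk hk'
    rw [multinom_eq_zero, zero_mul, map_zero, zero_mul]
    by_contra hlt
    exact hk' (Finset.mem_filter.2 ⟨hk, Finset.mem_range.2 (by omega)⟩)

theorem dvd_prod_sub_prod {R ι : Type*} [CommRing R] (s : Finset ι) (F G : ι → R) {P : R}
    (h : ∀ i ∈ s, P ∣ F i - G i) : P ∣ ∏ i ∈ s, F i - ∏ i ∈ s, G i := by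
  classical
  induction s using Finset.induction_on with
  | empty => simp
  | insert a s ha ih =>
    rw [Finset.prod_insert ha, Finset.prod_insert ha]
    have h1 := ih fun i hi => h i (Finset.mem_insert_of_mem hi)
    have h2 := h a (Finset.mem_insert_self _ _)
    have : F a * ∏ i ∈ s, F i - G a * ∏ i ∈ s, G i =
      F a * (∏ i ∈ s, F i - ∏ i ∈ s, G i) + (F a - G a) * ∏ i ∈ s, G i := by ring
    rw [this]
    exact dvd_add (dvd_mul_of_dvd_right h1 _) (dvd_mul_of_dvd_left h2 _)

theorem X_pow_dvd_expand_sub {d : ℕ} (hd : d ≠ 0) (n : ℕ) {F : ℚ⟦X⟧}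
    (hF : PowerSeries.coeff 0 F = 1) :
    PowerSeries.X ^ (n + 1) ∣ PowerSeries.expand d hd F -
      (1 + ∑ i : Fin n, PowerSeries.C (PowerSeries.coeff (i + 1) F) *
        PowerSeries.X ^ ((i + 1 : ℕ) * d)) := by
  rw [PowerSeries.X_pow_dvd_iff]
  intro m hm
  rw [map_sub, sub_eq_zero, map_add, map_sum, PowerSeries.coeff_one, PowerSeries.coeff_expand]
  simp only [PowerSeries.coeff_C_mul_X_pow]
  rcases eq_or_ne m 0 with rfl | hm0
  · rw [if_pos (dvd_zero _), Nat.zero_div, hF, if_pos rfl, Finset.sum_eq_zero, add_zero]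
    exact fun i _ => if_neg (mul_ne_zero (Nat.succ_ne_zero _) hd).symm
  rw [if_neg hm0, zero_add]
  split_ifs with hdm
  · obtain ⟨j, rfl⟩ := hdm
    have hj : j ≠ 0 := by rintro rfl; exact hm0 (mul_zero _)
    have hjn : j ≤ n := (Nat.le_mul_of_pos_left j (Nat.pos_of_ne_zero hd)).trans (by omega)
    rw [Nat.mul_div_cancel_left _ (Nat.pos_of_ne_zero hd),
      Finset.sum_eq_single (⟨j - 1, by omega⟩ : Fin n)]
    · have : j - 1 + 1 = j := by omega
      simp only [this]
      rw [if_pos (mul_comm _ _)]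
    · intro i _ hi
      refine if_neg fun h => hi (Fin.ext ?_)
      rw [mul_comm] at h
      have := Nat.eq_of_mul_eq_mul_right (Nat.pos_of_ne_zero hd) h
      simp only
      omega
    · simp
  · rw [Finset.sum_eq_zero]
    exact fun i _ => if_neg fun h => hdm ⟨i + 1, by rw [h, mul_comm]⟩

/-- Pairs of positive integers that are at most `n`. -/
def pairEmb (n : ℕ) : Fin n × Fin n ↪ ℕ+ × ℕ+ where
  toFun i := (Nat.succPNat i.1, Nat.succPNat i.2)
  inj' i j h := by
    have h1 := Nat.succPNat_injective (congrArg Prod.fst h)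
    have h2 := Nat.succPNat_injective (congrArg Prod.snd h)
    exact Prod.ext (Fin.ext h1) (Fin.ext h2)

/-- The multiplicity function on all pairs given by its values on small pairs `(m, d)`, the
argument `d` coming first. -/
def pairFinsupp (n : ℕ) (x : Fin n → Fin n → ℕ) : ℕ+ × ℕ+ →₀ ℕ :=
  (Finsupp.equivFunOnFinite.symm fun i : Fin n × Fin n => x i.2 i.1).embDomain (pairEmb n)

theorem pairFinsupp_apply {n : ℕ} (x : Fin n → Fin n → ℕ) (m d : Fin n) :
    pairFinsupp n x (Nat.succPNat m, Nat.succPNat d) = x d m :=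
  Finsupp.embDomain_apply_self (pairEmb n) _ (m, d)

theorem support_pairFinsupp {n : ℕ} (x : Fin n → Fin n → ℕ) :
    (pairFinsupp n x).support = (Finset.univ.filter fun i : Fin n × Fin n => x i.2 i.1 ≠ 0).map
      (pairEmb n) := by
  rw [pairFinsupp, Finsupp.support_embDomain]
  congr 1
  ext i
  simp

@[to_additive]
theorem prod_filter_support_pairFinsupp {M : Type*} [CommMonoid M] {n : ℕ}
    (x : Fin n → Fin n → ℕ) (d : Fin n) (f : ℕ+ × ℕ+ → M)
    (hf : ∀ md, pairFinsupp n x md = 0 → f md = 1) :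
    ∏ md ∈ (pairFinsupp n x).support.filter (fun md => md.2 = Nat.succPNat d), f md =
      ∏ m : Fin n, f (Nat.succPNat m, Nat.succPNat d) := by
  classical
  refine Eq.trans (Finset.prod_subset ?_ ?_) (Finset.prod_map Finset.univ
    (⟨fun m : Fin n => (Nat.succPNat m, Nat.succPNat d), fun i j h =>
      Fin.ext (Nat.succPNat_injective (congrArg Prod.fst h))⟩ : Fin n ↪ ℕ+ × ℕ+) f)
  · intro md hmd
    rw [Finset.mem_filter, support_pairFinsupp, Finset.mem_map] at hmd
    obtain ⟨⟨i, -, rfl⟩, hi⟩ := hmd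
    exact Finset.mem_map.2 ⟨i.1, Finset.mem_univ _, Prod.ext rfl hi.symm⟩
  · intro md hmd hmd'
    refine hf md ?_
    by_contra h
    obtain ⟨m, -, rfl⟩ := Finset.mem_map.1 hmd
    exact hmd' (Finset.mem_filter.2 ⟨Finsupp.mem_support_iff.2 h, rfl⟩)

@[to_additive]
theorem prod_support_pairFinsupp {M : Type*} [CommMonoid M] {n : ℕ} (x : Fin n → Fin n → ℕ)
    (f : ℕ+ × ℕ+ → M) (hf : ∀ md, pairFinsupp n x md = 0 → f md = 1) :
    ∏ md ∈ (pairFinsupp n x).support, f md =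
      ∏ d : Fin n, ∏ m : Fin n, f (Nat.succPNat m, Nat.succPNat d) := by
  classical
  rw [← Finset.prod_product_right', Finset.univ_product_univ]
  refine Eq.trans (Finset.prod_subset ?_ ?_) (Finset.prod_map Finset.univ (pairEmb n) f)
  · rw [support_pairFinsupp]
    exact Finset.map_subset_map.2 (Finset.subset_univ _)
  · intro md _ hmd
    exact hf md (Finsupp.notMem_support_iff.1 hmd)

theorem prod_pnatUpTo {M : Type*} [CommMonoid M] (n : ℕ) (f : ℕ+ → M) :
    ∏ d ∈ pnatUpTo n, f d = ∏ d : Fin n, f (Nat.succPNat d) :=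
  (Finset.prod_map _ _ _).trans (Fin.prod_univ_eq_prod_range (fun d => f (Nat.succPNat d)) n).symm

theorem pairFinsupp_mem_iff {n : ℕ} (x : Fin n → Fin n → ℕ) :
    pairFinsupp n x ∈ pairMultisets n ↔
      ∑ d : Fin n, ∑ m : Fin n, x d m * ((m + 1 : ℕ) * (d + 1 : ℕ)) = n := by
  change Finsupp.sum _ _ = n ↔ _
  rw [Finsupp.sum, sum_support_pairFinsupp]
  · simp only [pairFinsupp_apply, Nat.succPNat_coe, Nat.succ_eq_add_one]
  · intro md h
    rw [h, zero_mul]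

theorem prod_multinom_pairFinsupp {n : ℕ} (x : Fin n → Fin n → ℕ) (A : ℕ+ → ℤ) :
    ∏ d ∈ (pairFinsupp n x).support.image Prod.snd,
      multinom (A d) ((pairFinsupp n x).support.filter fun md => md.2 = d) (pairFinsupp n x) =
    ∏ d : Fin n, multinom (A (Nat.succPNat d)) Finset.univ (x d) := by
  classical
  have h1 : ∀ d : Fin n, multinom (A (Nat.succPNat d)) ((pairFinsupp n x).support.filter
      fun md => md.2 = Nat.succPNat d) (pairFinsupp n x) =
      multinom (A (Nat.succPNat d)) Finset.univ (x d) := by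
    intro d
    rw [multinom, multinom, sum_filter_support_pairFinsupp x d _ fun _ h => h,
      prod_filter_support_pairFinsupp x d (fun md => ((pairFinsupp n x md).factorial : ℚ))
        fun md h => by rw [h]; simp]
    simp only [pairFinsupp_apply]
  rw [← Finset.prod_congr rfl fun d _ => h1 d, ← prod_pnatUpTo n fun d =>
    multinom (A d) ((pairFinsupp n x).support.filter fun md => md.2 = d) (pairFinsupp n x)]
  refine Finset.prod_subset ?_ ?_
  · intro d hd
    obtain ⟨md, hmd, rfl⟩ := Finset.mem_image.1 hd
    rw [support_pairFinsupp] at hmd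
    obtain ⟨i, -, rfl⟩ := Finset.mem_map.1 hmd
    exact mem_pnatUpTo.2 i.2.2
  · intro d _ hd
    rw [Finset.filter_false_of_mem]
    · simp [multinom]
    · rintro md hmd rfl
      exact hd (Finset.mem_image_of_mem _ hmd)

theorem bijOn_pairFinsupp {n B : ℕ} (hB : n ≤ B) :
    Set.BijOn (pairFinsupp n)
      ((Fintype.piFinset fun _ : Fin n => Fintype.piFinset fun _ : Fin n =>
        Finset.range (B + 1)).filter fun x =>
          n = ∑ d : Fin n, ∑ m : Fin n, x d m * ((m + 1 : ℕ) * (d + 1 : ℕ)) : Finset _)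
      (pairMultisets n) := by
  refine ⟨fun x hx => ?_, fun x _ y _ h => ?_, fun e he => ?_⟩
  · exact (pairFinsupp_mem_iff x).2 (Finset.mem_filter.1 hx).2.symm
  · funext d m
    rw [← pairFinsupp_apply x, h, pairFinsupp_apply]
  · have hle : ∀ md, e md * (md.1 * md.2 : ℕ) ≤ n := by
      intro md
      by_cases hmd : md ∈ e.support
      · exact (Finset.single_le_sum (f := fun md => e md * (md.1 * md.2 : ℕ))
          (fun _ _ => Nat.zero_le _) hmd).trans (le_of_eq he)
      · rw [Finsupp.notMem_support_iff.1 hmd, zero_mul]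
        exact Nat.zero_le _
    have hx : pairFinsupp n (fun d m => e (Nat.succPNat m, Nat.succPNat d)) = e := by
      ext ⟨m, d⟩
      by_cases h : (m : ℕ) ≤ n ∧ (d : ℕ) ≤ n
      · have hm : Nat.succPNat (m.natPred) = m := m.succPNat_natPred
        have hd : Nat.succPNat (d.natPred) = d := d.succPNat_natPred
        have hm' := m.natPred_add_one
        have hd' := d.natPred_add_one
        have := pairFinsupp_apply (fun d m : Fin n => e (Nat.succPNat m, Nat.succPNat d))
          ⟨m.natPred, by omega⟩ ⟨d.natPred, by omega⟩
        simpa only [hm, hd] using this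
      · have h1 : e (m, d) = 0 := by
          by_contra h0
          have h2 := hle (m, d)
          have h3 : (m * d : ℕ) ≤ n :=
            (Nat.le_mul_of_pos_left _ (Nat.pos_of_ne_zero h0)).trans h2
          exact h ⟨(Nat.le_mul_of_pos_right _ d.pos).trans h3,
            (Nat.le_mul_of_pos_left _ m.pos).trans h3⟩
        rw [h1]
        refine Finsupp.embDomain_of_notMem_range _ _ _ ?_
        rintro ⟨i, hi⟩
        have hi1 : (m : ℕ) = i.1 + 1 := congrArg (fun md : ℕ+ × ℕ+ => (md.1 : ℕ)) hi.symm
        have hi2 : (d : ℕ) = i.2 + 1 := congrArg (fun md : ℕ+ × ℕ+ => (md.2 : ℕ)) hi.symm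
        exact h ⟨by omega, by omega⟩
    refine ⟨fun d m => e (Nat.succPNat m, Nat.succPNat d), ?_, hx⟩
    refine Finset.mem_filter.2 ⟨?_, ((pairFinsupp_mem_iff _).1 (hx.symm ▸ he)).symm⟩
    simp only [Fintype.mem_piFinset, Finset.mem_range]
    intro d m
    have := (Nat.le_mul_of_pos_right _ (Nat.mul_pos (Nat.succPNat m).pos
      (Nat.succPNat d).pos)).trans (hle (Nat.succPNat m, Nat.succPNat d))
    omega

theorem coeff_seriesTransform (A : ℕ → ℕ → ℕ) (F : ℕ → ℚ⟦X⟧)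
    (hF : ∀ q, PowerSeries.coeff 0 (F q) = 1) (q n : ℕ) :
    PowerSeries.coeff n (seriesTransform (fun d q => (A d q : ℤ)) F q) =
      PowerSeries.coeff n (∏ d ∈ pnatUpTo n,
        (PowerSeries.expand (d : ℕ) d.ne_zero (F (q ^ (d : ℕ)))) ^ A d q) := by
  classical
  rw [seriesTransform, PowerSeries.coeff_mk]
  split_ifs with hn
  · subst hn
    simp [pnatUpTo]
  set B : ℕ := n + ∑ d : Fin n, A (d + 1) q with hB
  have hAB : ∀ d : Fin n, A (d + 1) q ≤ B := fun d =>
    (Finset.single_le_sum (f := fun d : Fin n => A (d + 1) q) (fun _ _ => Nat.zero_le _)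
      (Finset.mem_univ d)).trans (Nat.le_add_left _ _)
  have hD : ∏ d ∈ pnatUpTo n,
      (PowerSeries.expand (d : ℕ) d.ne_zero (F (q ^ (d : ℕ)))) ^ A d q =
      ∏ d : Fin n, (PowerSeries.expand (Nat.succPNat d : ℕ) (Nat.succPNat d).ne_zero
        (F (q ^ (Nat.succPNat d : ℕ)))) ^ A (d + 1) q :=
    prod_pnatUpTo n fun d => (PowerSeries.expand (d : ℕ) d.ne_zero (F (q ^ (d : ℕ)))) ^ A d q
  rw [hD]
  rw [coeff_eq_of_X_pow_dvd (dvd_prod_sub_prod Finset.univ _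
    (fun d : Fin n => (1 + ∑ i : Fin n, PowerSeries.C (PowerSeries.coeff (i + 1)
      (F (q ^ (Nat.succPNat d : ℕ)))) * PowerSeries.X ^ ((i + 1 : ℕ) * (d + 1))) ^ A (d + 1) q)
    fun d _ => (X_pow_dvd_expand_sub (Nat.succPNat d).ne_zero n (hF _)).trans
      (sub_dvd_pow_sub_pow _ _ _))]
  rw [Finset.prod_congr rfl fun d _ => one_add_sum_pow (hAB d) _ _, Finset.prod_univ_sum, map_sum]
  simp only [Finset.prod_mul_distrib, ← map_prod, Finset.prod_pow_eq_pow_sum,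
    PowerSeries.coeff_C_mul_X_pow]
  rw [← Finset.sum_filter, seqTransform, ← finsum_mem_coe_finset]
  symm
  refine finsum_mem_eq_of_bijOn (pairFinsupp n) (bijOn_pairFinsupp (Nat.le_add_right _ _))
    fun x _ => ?_
  rw [prod_multinom_pairFinsupp x (fun d => (A d q : ℤ)),
    prod_support_pairFinsupp x _ (fun md h => by rw [h, pow_zero])]
  simp only [pairFinsupp_apply, Nat.succPNat_coe, Nat.succ_eq_add_one]

end Transform

end

end PPrimary

theorem theorem5p4 (p : ℕ) [Fact p.Prime] (q : ℕ) (hq : IsPrimePow q) (r : ℕ) (hr : 1 ≤ r) :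
    PPrimary.genFun p (r + 1) q =
        PPrimary.seriesTransform (fun d q' => (PPrimary.irrCount p d q' : ℤ))
          (PPrimary.genFun p r) q ∧
      PPrimary.HasFormalProd
        (fun d : ℕ+ =>
          (PowerSeries.expand (d : ℕ) d.ne_zero (PPrimary.genFun p r (q ^ (d : ℕ)))) ^
            PPrimary.irrCount p d q)
        (PPrimary.genFun p (r + 1) q) := by
  refine ⟨PowerSeries.ext fun n => ?_, PPrimary.hasFormalProd_genFun hq hr⟩
  rw [PPrimary.coeff_genFun_succ hq hr, PPrimary.coeff_seriesTransform _ _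
    (PPrimary.coeff_zero_genFun r)]
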